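/- Let $G=(V,E)$ be a finite simple undirected graph with $n=|V|\ge 2$ vertices. An ordering of $G$ is a bijection $\sigma:V\to\{1,\dots,n\}$; write $u\prec_\sigma v$ if $\sigma(u)<\sigma(v)$. The graph $G$ is an interval graph if its vertices can be represented by closed intervals of the real line so that two distinct vertices are adjacent if and only if their intervals intersect. An ordering $\sigma$ is a cocomparability order of $G$ if for all $a\prec_\sigma b\prec_\sigma c$ with $ac\in E$ we have $ab\in E$ or $bc\in E$. For an ordering $\sigma$, let $\mathrm{LexBFS}^+(\sigma)$ be the ordering produced by the following search. Initially the last vertex of $\sigma$ has label $(n+1)$ and all other vertices have the empty label. For $i=1,\dots,n$: among the unnumbered vertices with lexicographically largest label, choose the vertex $v$ that is rightmost in $\sigma$; give it number $i$; append the letter $n-i$ to the label of each unnumbered neighbour of $v$. Let $\mathrm{LexCycle}(G)$ be the maximum length of a cycle of the map $\sigma\mapsto\mathrm{LexBFS}^+(\sigma)$ on the set of orderings of $G$. Theorem. If $G$ is an interval graph with $n\ge 2$ vertices, then $\mathrm{LexCycle}(G)=2$. Moreover, let $\sigma_0$ be an arbitrary ordering of $G$ and $\sigma_{i+1}=\mathrm{LexBFS}^+(\sigma_i)$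 for $i\ge 0$. Then there is a $j$ with $1\le j\le n$ such that $\sigma_j$ is a cocomparability order of $G$. And for every $j\ge 1$ such that $\sigma_j$ is a cocomparability order, $\sigma_{i+2}=\sigma_i\neq\sigma_{i+1}$ for all $i\ge j+1$; that is, from the next sweep on the sequence alternates between two distinct orderings. -/

import Mathlib

namespace LexBFS

/-- An ordering of the vertex set: a bijection from `V` onto the `n = |V|` positions
`0, 1, …, n - 1`. The vertex `u` is to the left of `v` in `σ` when `σ u < σ v`. -/
abbrev Ordering (V : Type*) [Fintype V] : Type _ := V ≃ Fin (Fintype.card V)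

/-- `G` is an interval graph: its vertices can be represented by nonempty closed intervals
`[l v, r v]` of the real line so that two distinct vertices are adjacent exactly when their
intervals intersect. -/
def IsIntervalGraph {V : Type*} (G : SimpleGraph V) : Prop :=
  ∃ l r : V → ℝ, (∀ v, l v ≤ r v) ∧
    ∀ u v, u ≠ v → (G.Adj u v ↔ (Set.Icc (l u) (r u) ∩ Set.Icc (l v) (r v)).Nonempty)

/-- `σ` is a cocomparability order of `G`: for every triple `a, b, c` from left to right,
if `ac` is an edge then `ab` or `bc` is an edge. -/
def IsCocompOrder {V : Type*} [Fintype V] (G : SimpleGraph V) (σ : Ordering V) : Prop :=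
  ∀ a b c : V, σ a < σ b → σ b < σ c → G.Adj a c → G.Adj a b ∨ G.Adj b c

/-- A state of the search: the vertices numbered so far, in the order in which they were
numbered, and the current label of every vertex (a word of natural numbers). -/
structure State (V : Type*) where
  visited : List V
  label : V → List ℕ

/-- The vertex of the nonempty set `T` that is rightmost in `σ`. -/
def rightmost {V : Type*} [Fintype V] (σ : Ordering V) (T : Finset V) (hT : T.Nonempty) : V :=
  σ.symm ((T.image σ).max' (hT.image σ))

theorem rightmost_mem {V : Type*} [Fintype V] (σ : Ordering V) (T : Finset V) (hT : T.Nonempty) :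
    rightmost σ T hT ∈ T := by
  have h := (T.image σ).max'_mem (hT.image σ)
  obtain ⟨v, hv, e⟩ := Finset.mem_image.mp h
  simpa [rightmost, ← e] using hv

section Search

variable {V : Type*} [Fintype V] [DecidableEq V]

/-- The unnumbered vertices. -/
def State.unnumbered (s : State V) : Finset V :=
  {v | v ∉ s.visited}

/-- The tied vertices: the unnumbered vertices whose label is lexicographically largest among
all unnumbered vertices (words are compared lexicographically, a proper prefix being smaller). -/
def State.tied (s : State V) : Finset V :=
  {v ∈ s.unnumbered | ∀ u ∈ s.unnumbered, s.label u ≤ s.label v}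

/-- The initial state of the search: no vertex is numbered; all labels are empty, except that the
start vertex (the last vertex of `σ`) has the one-letter label `n + 1`. -/
def initialState (σ : Ordering V) : State V where
  visited := []
  label v := if (σ v : ℕ) + 1 = Fintype.card V then [Fintype.card V + 1] else []

variable (G : SimpleGraph V) [DecidableRel G.Adj]

/-- Number the vertex `v`: it becomes the `i`-th numbered vertex (counting from `1`), and the
letter `n - i` is appended to the label of each vertex adjacent to `v` and still unnumbered. -/
def State.number (s : State V) (v : V) : State V where
  visited := s.visited ++ [v]
  label w :=
    if w ∉ s.visited ++ [v] ∧ G.Adj v w then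
      s.label w ++ [Fintype.card V - (s.visited.length + 1)]
    else s.label w

/-- One step of the search: number the tied vertex that is rightmost in `σ`
(and do nothing when all vertices are numbered). -/
def step (σ : Ordering V) (s : State V) : State V :=
  if h : s.tied.Nonempty then s.number G (rightmost σ s.tied h) else s

/-- The state after `k` steps. -/
def run (σ : Ordering V) (k : ℕ) : State V :=
  (step G σ)^[k] (initialState σ)

theorem State.tied_nonempty (s : State V) (h : s.unnumbered.Nonempty) : s.tied.Nonempty := by
  obtain ⟨v, hv, hmax⟩ := Finset.exists_max_image s.unnumbered s.label h
  exact ⟨v, Finset.mem_filter.mpr ⟨hv, hmax⟩⟩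

theorem run_visited (σ : Ordering V) (k : ℕ) (hk : k ≤ Fintype.card V) :
    (run G σ k).visited.Nodup ∧ (run G σ k).visited.length = k := by
  induction k with
  | zero => simp [run, initialState]
  | succ k ih =>
    obtain ⟨hnd, hlen⟩ := ih (by omega)
    have hrun : run G σ (k + 1) = step G σ (run G σ k) := Function.iterate_succ_apply' _ _ _
    have hun : (run G σ k).unnumbered.Nonempty := by
      by_contra hne
      have hall : ∀ v, v ∈ (run G σ k).visited := by
        intro v
        by_contra hv
        exact hne ⟨v, by simpa [State.unnumbered] using hv⟩
      have hcard : Fintype.card V ≤ (run G σ k).visited.length := by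
        rw [← Finset.card_univ, ← List.toFinset_card_of_nodup hnd]
        exact Finset.card_le_card (fun v _ => List.mem_toFinset.mpr (hall v))
      omega
    have ht := (run G σ k).tied_nonempty hun
    have hmem : rightmost σ _ ht ∉ (run G σ k).visited := by
      have h1 := (Finset.mem_filter.mp (rightmost_mem σ _ ht)).1
      simpa [State.unnumbered] using h1
    rw [hrun, step, dif_pos ht]
    refine ⟨?_, by simp [State.number, hlen]⟩
    simp only [State.number]
    exact List.nodup_append.mpr ⟨hnd, by simp, by
      intro a ha b hb hab
      rw [List.mem_singleton] at hb
      exact hmem (by rw [← hb, ← hab]; exact ha)⟩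

theorem run_complete (σ : Ordering V) (v : V) :
    v ∈ (run G σ (Fintype.card V)).visited := by
  obtain ⟨hnd, hlen⟩ := run_visited G σ (Fintype.card V) le_rfl
  have h : (run G σ (Fintype.card V)).visited.toFinset = Finset.univ :=
    Finset.eq_univ_of_card _ (by rw [List.toFinset_card_of_nodup hnd, hlen])
  exact List.mem_toFinset.mp (h ▸ Finset.mem_univ v)

/-- The ordering `LexBFS⁺(G, σ)`: the vertices in the order in which the search numbers them. -/
def lexBFSPlus (σ : Ordering V) : Ordering V :=
  ((run_visited G σ (Fintype.card V) le_rfl).1.getEquivOfForallMemList _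
    (run_complete G σ)).symm.trans (finCongr (run_visited G σ (Fintype.card V) le_rfl).2)

/-- The sequence of sweeps `σ₀ = σ`, `σ_{i+1} = LexBFS⁺(G, σ_i)`. -/
def sweep (σ : Ordering V) (i : ℕ) : Ordering V :=
  (lexBFSPlus G)^[i] σ

/-- `LexCycle(G)`: the maximum length of a cycle of vertex orderings under `LexBFS⁺` sweeps.
The length of the cycle through a periodic `σ` is its minimal period (which is `0` by convention
for the orderings that do not lie on a cycle, so that these do not affect the maximum). -/
noncomputable def lexCycle : ℕ :=
  (Finset.univ : Finset (Ordering V)).sup fun σ => Function.minimalPeriod (lexBFSPlus G) σ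

end Search

end LexBFS

/-!
An interval representation of `G` orders the complement of `G`: `P a b` says that the interval of
`a` lies to the left of that of `b` (`IsIntervalOrder`). An ordering of the vertices is a
cocomparability order as soon as it is a linear extension of such an order. A `LexBFS⁺` sweep is
used only through its lexicographic characterisation `IsSweep`, proved for the search in
`isSweep_lexBFSPlus`; this relation restricts to modules. In a sweep of an interval graph the
neighbours of a vertex in front of it form a clique (`IsSweep.adj_of_earlier`).

*A cocomparability order is reached.* It is shown by induction on `|V|` that the sweeps converge
to one interval order `P`, with even sweeps extending `P` and odd sweeps extending its reverse
(`exists_isLimit`). A disconnected graph is handled componentwise, as a sweep reverses the order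
of the components. For a connected graph consider the longest prefix of a sweep that is correct
for `P` (`goodPart`). The vertex `z` that follows it has a vertex below it that comes later, and
`exists_module_of_bad` places `z` in a module outside the prefix. The sweeps enter each proper
module at a minimal vertex if `P` is chosen well: inside such a module `P` may be replaced by any
other interval order (`IsIntervalOrder.substitute`), and the choice with the fewest pairs that do
not settle agrees with the limit orders of all modules (`exists_startsRight`). With this choice
the good part grows by at least two vertices in every two sweeps (`StartsRight.ncard_goodPart`),
so that it is everything after `|V|` sweeps.

*Afterwards the sweeps alternate.* A sweep that is a cocomparability order lists the vertices as
the left endpoints of an interval representation do (`IsSweep.isLeftOrder`), and the next sweep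
sorts them by decreasing right endpoint, with ties resolved by decreasing left endpoint
(`IsSweep.endpoints_lt`). Computing the endpoints after two further sweeps shows that the third
sweep equals the first (`IsLeftOrder.lt_of_three_sweeps`). Two successive sweeps differ, since a
sweep starts with the last vertex of the preceding ordering.
-/

namespace LexBFS

/-! ### Interval orders on the complement -/

/-- `P` is an interval order whose incomparability graph is `G`: a transitive orientation of the
complement of `G` without an induced `2 + 2` (this is `cross`). -/
structure IsIntervalOrder {V : Type*} (G : SimpleGraph V) (P : V → V → Prop) : Prop where
  not_adj : ∀ {a b}, P a b → ¬ G.Adj a b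
  asymm : ∀ {a b}, P a b → ¬ P b a
  trans : ∀ {a b c}, P a b → P b c → P a c
  total : ∀ {a b}, a ≠ b → ¬ G.Adj a b → P a b ∨ P b a
  cross : ∀ {a b c d}, P a b → P c d → P a d ∨ P c b

section

variable {V : Type*} {G : SimpleGraph V} {P : V → V → Prop}

theorem IsIntervalOrder.irrefl (hP : IsIntervalOrder G P) (a : V) : ¬ P a a :=
  fun h => hP.asymm h h

theorem IsIntervalOrder.ne (hP : IsIntervalOrder G P) {a b : V} (h : P a b) : a ≠ b := by
  rintro rfl
  exact hP.irrefl _ h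

theorem IsIntervalOrder.swap (hP : IsIntervalOrder G P) : IsIntervalOrder G (fun a b => P b a) where
  not_adj h h' := hP.not_adj h h'.symm
  asymm h := hP.asymm h
  trans h h' := hP.trans h' h
  total h h' := (hP.total h h').symm
  cross h h' := (hP.cross h h').symm

/-- The incomparability graph of an interval order has no induced four-cycle. -/
theorem IsIntervalOrder.chord (hP : IsIntervalOrder G P) {a b c d : V} (hab : G.Adj a b)
    (hbc : G.Adj b c) (hcd : G.Adj c d) (hda : G.Adj d a) (hac : P a c) (hne : b ≠ d) :
    G.Adj b d := by
  by_contra hbd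
  rcases hP.total hne hbd with h | h
  · rcases hP.cross hac h with h' | h'
    · exact hP.not_adj h' hda.symm
    · exact hP.not_adj h' hbc
  · rcases hP.cross hac h with h' | h'
    · exact hP.not_adj h' hab
    · exact hP.not_adj h' hcd.symm

/-- Over a graph that carries an interval order, every transitive orientation of the complement
is an interval order. -/
theorem IsIntervalOrder.of_trans (hP : IsIntervalOrder G P) {Q : V → V → Prop}
    (not_adj : ∀ {a b}, Q a b → ¬ G.Adj a b) (asymm : ∀ {a b}, Q a b → ¬ Q b a)
    (trans : ∀ {a b c}, Q a b → Q b c → Q a c)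
    (total : ∀ {a b}, a ≠ b → ¬ G.Adj a b → Q a b ∨ Q b a) : IsIntervalOrder G Q where
  not_adj := not_adj
  asymm := asymm
  trans := trans
  total := total
  cross {a b c d} hab hcd := by
    by_contra! h
    obtain ⟨had, hcb⟩ := h
    have hnab : a ≠ b := by rintro rfl; exact asymm hab hab
    have hncd : c ≠ d := by rintro rfl; exact asymm hcd hcd
    have h1 : G.Adj a d := by
      by_contra h1
      rcases eq_or_ne a d with rfl | hne
      · exact hcb (trans hcd hab)
      rcases total hne h1 with h | h
      · exact had h
      · exact hcb (trans hcd (trans h hab))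
    have h2 : G.Adj c b := by
      by_contra h2
      rcases eq_or_ne c b with rfl | hne
      · exact had (trans hab hcd)
      rcases total hne h2 with h | h
      · exact hcb h
      · exact had (trans hab (trans h hcd))
    have h3 : G.Adj a c := by
      by_contra h3
      rcases eq_or_ne a c with rfl | hne
      · exact had hcd
      rcases total hne h3 with h | h
      · exact had (trans h hcd)
      · exact hcb (trans h hab)
    have h4 : G.Adj b d := by
      by_contra h4
      rcases eq_or_ne b d with rfl | hne
      · exact had hab
      rcases total hne h4 with h | h
      · exact had (trans hab h)
      · exact hcb (trans hcd h)
    rcases hP.total hnab (not_adj hab) with h | h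
    · exact not_adj hcd (hP.chord h1 h4.symm h2.symm h3.symm h hncd.symm).symm
    · exact not_adj hcd (hP.chord h2.symm h3.symm h1 h4.symm h hncd)

/-- Every vertex is comparable with the vertices it is not adjacent to. -/
theorem IsIntervalOrder.left (hP : IsIntervalOrder G P) {a b : V} (h : ¬ G.Adj a b) (hne : a ≠ b)
    (h' : ¬ P b a) : P a b :=
  (hP.total hne h).resolve_right h'

/-! ### Sweeps as a relation between orderings -/

/-- `τ` is the `LexBFS⁺` ordering of `G` obtained from `σ`, where the two orderings are given by
the positions of the vertices (arbitrary natural numbers, so that orderings can be restricted to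
sets of vertices). If `a` precedes `b` in `τ`, then either the first vertex of `τ` in front of `a`
that distinguishes `a` from `b` is adjacent to `a`, or nothing in front of `a` distinguishes
them and `b` precedes `a` in `σ`. -/
structure IsSweep (G : SimpleGraph V) (σ τ : V → ℕ) : Prop where
  inj : Function.Injective τ
  lex : ∀ {a b}, τ a < τ b →
    (∃ c, τ c < τ a ∧ G.Adj c a ∧ ¬ G.Adj c b ∧ ∀ d, τ d < τ c → (G.Adj d a ↔ G.Adj d b)) ∨
    ((∀ c, τ c < τ a → (G.Adj c a ↔ G.Adj c b)) ∧ σ b < σ a)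

variable {σ τ ρ : V → ℕ}

/-- If a vertex in front of `a` is adjacent to `b` but not to `a`, then the first vertex that
distinguishes `a` from `b` is still further to the left, and adjacent to `a`. -/
theorem IsSweep.exists_private (h : IsSweep G σ τ) {a b c : V} (hab : τ a < τ b) (hca : τ c < τ a)
    (h1 : G.Adj c b) (h2 : ¬ G.Adj c a) :
    ∃ d, τ d < τ c ∧ G.Adj d a ∧ ¬ G.Adj d b ∧ ∀ e, τ e < τ d → (G.Adj e a ↔ G.Adj e b) := by
  rcases h.lex hab with ⟨d, hda, hd1, hd2, hd3⟩ | ⟨h3, -⟩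
  · refine ⟨d, ?_, hd1, hd2, hd3⟩
    by_contra hlt
    rcases (not_lt.mp hlt).lt_or_eq with h4 | h4
    · exact h2 ((hd3 c h4).mpr h1)
    · exact hd2 (h.inj h4 ▸ h1)
  · exact absurd ((h3 c hca).mpr h1) h2

/-- If every vertex in front of `a` that is adjacent to `a` is adjacent to the later vertex `b`,
then `a` and `b` are tied when `a` is chosen, so that `b` precedes `a` in `σ`. -/
theorem IsSweep.tie (h : IsSweep G σ τ) {a b : V} (hab : τ a < τ b)
    (h1 : ∀ c, τ c < τ a → G.Adj c a → G.Adj c b) :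
    (∀ c, τ c < τ a → (G.Adj c a ↔ G.Adj c b)) ∧ σ b < σ a := by
  rcases h.lex hab with ⟨d, hda, hd1, hd2, -⟩ | h3
  · exact absurd (h1 d hda hd1) hd2
  · exact h3

theorem exists_first (τ : V → ℕ) (p : V → Prop) (h : ∃ a, p a) :
    ∃ a, p a ∧ ∀ b, p b → τ a ≤ τ b := by
  classical
  have h' : ∃ n, ∃ a, p a ∧ τ a = n := by
    obtain ⟨a, ha⟩ := h
    exact ⟨_, a, ha, rfl⟩
  obtain ⟨a, ha, hn⟩ := Nat.find_spec h'
  exact ⟨a, ha, fun b hb => hn ▸ Nat.find_min' h' ⟨b, hb, rfl⟩⟩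

/-- The descent behind `IsSweep.adj_of_earlier`: from `p`, `q`, on different sides of `c` and
such that `p` makes `o` differ from `q`, one finds a vertex in front of `p`, on the side of `q`,
with the same properties. -/
theorem IsSweep.no_alternation (h : IsSweep G σ τ) (hP : IsIntervalOrder G P) {c : V} :
    ∀ n : ℕ, ∀ p q o : V, τ p = n → τ p < τ q → τ q < τ o → τ o < τ c → G.Adj p o →
      (P p c ∧ P c q ∨ P c p ∧ P q c) →
      (∀ v, τ v < τ p → (G.Adj v o ↔ G.Adj v c)) → False := by
  intro n
  induction n using Nat.strong_induction_on with
  | _ n ih =>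
    intro p q o hn hpq hqo hoc hpo hside hagree
    have hnpq : ¬ G.Adj p q := by
      rcases hside with ⟨h1, h2⟩ | ⟨h1, h2⟩
      · exact hP.not_adj (hP.trans h1 h2)
      · exact fun h3 => hP.not_adj (hP.trans h2 h1) h3.symm
    obtain ⟨d, hdp, hdq, hdo, hd⟩ := h.exists_private hqo hpq hpo hnpq
    have hdc : ¬ G.Adj d c := fun h1 => hdo ((hagree d hdp).mpr h1)
    have hne : d ≠ c := by rintro rfl; omega
    refine ih (τ d) (hn ▸ hdp) d p q rfl hdp hpq (by omega) hdq ?_ fun v hv =>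
      (hd v hv).trans (hagree v (by omega))
    rcases hside with ⟨h1, h2⟩ | ⟨h1, h2⟩
    · exact .inr ⟨hP.left (fun h3 => hdc h3.symm) hne.symm
        fun h3 => hP.not_adj (hP.trans h3 h2) hdq, h1⟩
    · exact .inl ⟨hP.left hdc hne
        fun h3 => hP.not_adj (hP.trans h2 h3) hdq.symm, h1⟩

/-- In a `LexBFS` ordering of an interval graph, the neighbours of a vertex in front of it form a
clique. -/
theorem IsSweep.adj_of_earlier (h : IsSweep G σ τ) (hP : IsIntervalOrder G P) {a b c : V}
    (hac : τ a < τ c) (hbc : τ b < τ c) (h1 : G.Adj a c) (h2 : G.Adj b c) (hne : a ≠ b) :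
    G.Adj a b := by
  wlog hab : τ a < τ b generalizing a b
  · have hlt : τ b < τ a := lt_of_le_of_ne (not_lt.mp hab) fun h3 => hne (h.inj h3).symm
    exact (this hbc hac h2 h1 hne.symm hlt).symm
  by_contra hnab
  wlog hPab : P a b generalizing P
  · exact this hP.swap ((hP.total hne hnab).resolve_left hPab)
  obtain ⟨d, hda, hdb, hdc, hd⟩ := h.exists_private hbc hab h1 hnab
  have hdcne : d ≠ c := by rintro rfl; omega
  have hdna : ¬ G.Adj d a := fun h3 =>
    hdc (hP.chord h1 h2.symm hdb.symm h3 hPab hdcne.symm).symm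
  have hPcd : P c d := hP.left (fun h3 => hdc h3.symm) hdcne.symm fun h3 => by
    rcases hP.cross hPab h3 with h4 | h4
    · exact hP.not_adj h4 h1
    · exact hP.not_adj h4 hdb
  obtain ⟨e, hed, hea, heb, he⟩ := h.exists_private hab hda hdb hdna
  have hec : ¬ G.Adj e c := fun h3 => heb ((hd e hed).mpr h3)
  have hecne : e ≠ c := by rintro rfl; omega
  have hPec : P e c := hP.left hec hecne fun h3 => by
    rcases hP.cross hPab h3 with h4 | h4
    · exact hP.not_adj h4 hea.symm
    · exact hP.not_adj h4 h2.symm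
  exact h.no_alternation hP _ e d a rfl hed hda hac hea (.inl ⟨hPec, hPcd⟩) fun v hv =>
    (he v hv).trans (hd v (hv.trans hed))

/-! ### Good prefixes -/

/-- `D` is a prefix of the ordering `σ`, and every vertex of `D` is preceded in `σ` by all vertices
that lie below it in `P`. -/
structure IsGoodPrefix (P : V → V → Prop) (σ : V → ℕ) (D : Set V) : Prop where
  lower : ∀ {a b}, a ∈ D → σ b < σ a → b ∈ D
  good : ∀ {a b}, a ∈ D → σ a < σ b → ¬ P b a

theorem isGoodPrefix_empty : IsGoodPrefix P σ ∅ := ⟨fun h => h.elim, fun h => h.elim⟩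

theorem IsGoodPrefix.lt_of_mem {D : Set V} (hD : IsGoodPrefix P σ D) (hσ : Function.Injective σ)
    {a b : V} (ha : a ∈ D) (hb : b ∉ D) : σ a < σ b := by
  rcases lt_trichotomy (σ a) (σ b) with h | h | h
  · exact h
  · exact absurd (hσ h ▸ ha) hb
  · exact absurd (hD.lower ha h) hb

/-- A good prefix is a lower set of the interval order. -/
theorem IsGoodPrefix.not_below {D : Set V} (hD : IsGoodPrefix P σ D) (hσ : Function.Injective σ)
    {a b : V} (ha : a ∈ D) (hb : b ∉ D) : ¬ P b a :=
  hD.good ha (hD.lt_of_mem hσ ha hb)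

/-- A nonadjacent pair is in the right order if one of its vertices is in a good prefix. -/
theorem IsGoodPrefix.below (hP : IsIntervalOrder G P) {D : Set V} (hD : IsGoodPrefix P σ D)
    (hσ : Function.Injective σ) {a b : V} (ha : a ∈ D) (hb : b ∉ D) (h : ¬ G.Adj a b) : P a b :=
  hP.left h (fun h1 => hb (h1 ▸ ha)) (hD.not_below hσ ha hb)

/-- The traces on a good prefix of the neighbourhoods of two outside vertices are nested. -/
theorem IsGoodPrefix.nested (hP : IsIntervalOrder G P) {D : Set V} (hD : IsGoodPrefix P σ D)
    (hσ : Function.Injective σ) {a b c d : V} (ha : a ∉ D) (hb : b ∉ D) (hc : c ∈ D) (hd : d ∈ D)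
    (hca : G.Adj c a) (hcb : ¬ G.Adj c b) (hdb : G.Adj d b) : G.Adj d a := by
  by_contra hda
  rcases hP.cross (hD.below hP hσ hc hb hcb) (hD.below hP hσ hd ha hda) with h | h
  · exact hP.not_adj h hca
  · exact hP.not_adj h hdb

/-- If `p` is below `u` but comes after `u` in the `LexBFS` ordering `σ`, then no vertex of a good
prefix distinguishes `p` from `u`. -/
theorem IsGoodPrefix.homogeneous (hP : IsIntervalOrder G P) {D : Set V} (hD : IsGoodPrefix P σ D)
    {π : V → ℕ} (hσ : IsSweep G π σ) {p u : V} (hpu : P p u) (hup : σ u < σ p) :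
    u ∉ D ∧ p ∉ D ∧ ∀ e ∈ D, (G.Adj e p ↔ G.Adj e u) := by
  have hu : u ∉ D := fun h => hD.good h hup hpu
  have hp : p ∉ D := fun h => hu (hD.lower h hup)
  refine ⟨hu, hp, fun e he => ⟨fun h1 => ?_, fun h1 => ?_⟩⟩
  · by_contra h2
    obtain ⟨d, hde, hdu, hdp, -⟩ :=
      hσ.exists_private hup (hD.lt_of_mem hσ.inj he hu) h1 h2
    exact hP.not_adj (hP.trans (hD.below hP hσ.inj (hD.lower he hde) hp hdp) hpu) hdu
  · by_contra h2
    exact hP.not_adj (hP.trans (hD.below hP hσ.inj he hp h2) hpu) h1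

/-! ### Modules -/

/-- No vertex outside `M` distinguishes two vertices of `M`. -/
def IsModule (G : SimpleGraph V) (M : Set V) : Prop :=
  ∀ c ∉ M, ∀ a ∈ M, ∀ b ∈ M, (G.Adj c a ↔ G.Adj c b)

/-- Every outside vertex has the same position in `P` relative to all vertices of `M`. -/
def IsHomogeneous (P : V → V → Prop) (M : Set V) : Prop :=
  ∀ c ∉ M, ∀ a ∈ M, ∀ b ∈ M, (P c a ↔ P c b) ∧ (P a c ↔ P b c)

theorem IsHomogeneous.swap {M : Set V} (h : IsHomogeneous P M) :
    IsHomogeneous (fun a b => P b a) M :=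
  fun c hc a ha b hb => ⟨(h c hc a ha b hb).2, (h c hc a ha b hb).1⟩

/-- The vertices of `M` together with those that lie between two vertices of `M`. -/
def hull (P : V → V → Prop) (M : Set V) : Set V :=
  {c | c ∈ M ∨ ∃ a ∈ M, ∃ b ∈ M, P a c ∧ P c b}

theorem subset_hull (M : Set V) : M ⊆ hull P M := fun _ h => .inl h

theorem IsModule.adj_hull (hP : IsIntervalOrder G P) {M : Set V} (hM : IsModule G M) {w a c : V}
    (hw : w ∉ hull P M) (ha : a ∈ M) (hc : c ∈ hull P M) : G.Adj w c ↔ G.Adj w a := by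
  have hwM : w ∉ M := fun h => hw (subset_hull M h)
  rcases hc with hc | ⟨b, hb, d, hd, hbc, hcd⟩
  · exact hM w hwM c hc a ha
  · have hne : w ≠ c := by
      rintro rfl
      exact hw (.inr ⟨b, hb, d, hd, hbc, hcd⟩)
    constructor
    · intro h1
      by_contra h2
      have h3 : P w b := hP.left (fun h => h2 ((hM w hwM b hb a ha).mp h))
        (fun h => hwM (h ▸ hb)) fun h => by
          have h4 : P w d := hP.left (fun h => h2 ((hM w hwM d hd a ha).mp h))
            (fun h => hwM (h ▸ hd)) fun h5 => hP.not_adj (hP.trans hcd h5) h1.symm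
          exact hw (.inr ⟨b, hb, d, hd, h, h4⟩)
      exact hP.not_adj (hP.trans h3 hbc) h1
    · intro h1
      by_contra h2
      rcases hP.total hne h2 with h | h
      · exact hP.not_adj (hP.trans h hcd) ((hM w hwM a ha d hd).mp h1)
      · exact hP.not_adj (hP.trans hbc h) ((hM w hwM a ha b hb).mp h1).symm

theorem IsModule.hull (hP : IsIntervalOrder G P) {M : Set V} (hM : IsModule G M)
    (hne : M.Nonempty) : IsModule G (hull P M) := by
  obtain ⟨m, hm⟩ := hne
  exact fun c hc a ha b hb => (hM.adj_hull hP hc hm ha).trans (hM.adj_hull hP hc hm hb).symm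

theorem IsModule.isHomogeneous_hull (hP : IsIntervalOrder G P) {M : Set V} (hM : IsModule G M)
    (hne : M.Nonempty) : IsHomogeneous P (LexBFS.hull P M) := by
  obtain ⟨m, hm⟩ := hne
  -- a vertex outside the hull that is not adjacent to `m` lies below all of `M` or above all of `M`
  have key : ∀ c ∉ LexBFS.hull P M, ∀ a ∈ LexBFS.hull P M,
      (P c a ↔ P c m) ∧ (P a c ↔ P m c) := by
    intro c hc a ha
    have hcM : c ∉ M := fun h => hc (subset_hull M h)
    have hadj := hM.adj_hull hP hc hm ha
    have hca : c ≠ a := by rintro rfl; exact hc ha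
    have hcm : c ≠ m := by rintro rfl; exact hcM hm
    have hmem : ∀ x ∈ M, ∀ y ∈ M, P x c → P c y → False := fun x hx y hy h1 h2 =>
      hc (.inr ⟨x, hx, y, hy, h1, h2⟩)
    have hx : ∀ x ∈ M, ¬ G.Adj c m → P c x ∨ P x c := fun x hx h =>
      hP.total (fun h1 => hcM (h1 ▸ hx)) fun h1 => h ((hM c hcM x hx m hm).mp h1)
    have h1 : P c a → P c m := by
      intro h
      have hn : ¬ G.Adj c m := fun h' => hP.not_adj h (hadj.mpr h')
      rcases ha with ha | ⟨x, hx1, y, hy1, hxa, hay⟩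
      · exact (hx m hm hn).resolve_right fun h' => hmem m hm a ha h' h
      · have h3 : P c y := hP.trans h hay
        exact (hx m hm hn).resolve_right fun h' => hmem m hm y hy1 h' h3
    have h2 : P a c → P m c := by
      intro h
      have hn : ¬ G.Adj c m := fun h' => hP.not_adj h (hadj.mpr h').symm
      rcases ha with ha | ⟨x, hx1, y, hy1, hxa, hay⟩
      · exact (hx m hm hn).resolve_left fun h' => hmem a ha m hm h h'
      · have h3 : P x c := hP.trans hxa h
        exact (hx m hm hn).resolve_left fun h' => hmem x hx1 m hm h3 h'
    refine ⟨⟨h1, fun h => ?_⟩, ⟨h2, fun h => ?_⟩⟩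
    · have hn : ¬ G.Adj c a := fun h' => hP.not_adj h (hadj.mp h')
      exact (hP.total hca hn).resolve_right fun h' => hP.asymm h (h2 h')
    · have hn : ¬ G.Adj c a := fun h' => hP.not_adj h (hadj.mp h').symm
      exact (hP.total hca hn).resolve_left fun h' => hP.asymm h (h1 h')
  exact fun c hc a ha b hb => ⟨(key c hc a ha).1.trans (key c hc b hb).1.symm,
    (key c hc a ha).2.trans (key c hc b hb).2.symm⟩

open Classical in
/-- The relation obtained from `P` by replacing its restriction to `M` by `Q`. -/
def substitute (P : V → V → Prop) (M : Set V) (Q : M → M → Prop) (a b : V) : Prop :=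
  if h : a ∈ M ∧ b ∈ M then Q ⟨a, h.1⟩ ⟨b, h.2⟩ else P a b

theorem substitute_mem {M : Set V} {Q : M → M → Prop} {a b : V} (ha : a ∈ M) (hb : b ∈ M) :
    substitute P M Q a b ↔ Q ⟨a, ha⟩ ⟨b, hb⟩ := by
  simp [substitute, ha, hb]

theorem substitute_left {M : Set V} {Q : M → M → Prop} {a b : V} (ha : a ∉ M) :
    substitute P M Q a b ↔ P a b := by
  simp [substitute, ha]

theorem substitute_right {M : Set V} {Q : M → M → Prop} {a b : V} (hb : b ∉ M) :
    substitute P M Q a b ↔ P a b := by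
  simp [substitute, hb]

/-- A homogeneous module may be reordered independently of the rest of the graph. -/
theorem IsIntervalOrder.substitute (hP : IsIntervalOrder G P) {M : Set V} (hM : IsHomogeneous P M)
    {Q : M → M → Prop} (hQ : IsIntervalOrder (G.comap Subtype.val) Q) :
    IsIntervalOrder G (substitute P M Q) := by
  refine hP.of_trans ?_ ?_ ?_ ?_
  · intro a b h
    by_cases ha : a ∈ M
    · by_cases hb : b ∈ M
      · exact hQ.not_adj ((substitute_mem ha hb).mp h)
      · exact hP.not_adj ((substitute_right hb).mp h)
    · exact hP.not_adj ((substitute_left ha).mp h)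
  · intro a b h h'
    by_cases ha : a ∈ M
    · by_cases hb : b ∈ M
      · exact hQ.asymm ((substitute_mem ha hb).mp h) ((substitute_mem hb ha).mp h')
      · exact hP.asymm ((substitute_right hb).mp h) ((substitute_left hb).mp h')
    · exact hP.asymm ((substitute_left ha).mp h) ((substitute_right ha).mp h')
  · intro a b c hab hbc
    by_cases ha : a ∈ M <;> by_cases hb : b ∈ M <;> by_cases hc : c ∈ M
    · rw [substitute_mem ha hb] at hab
      rw [substitute_mem hb hc] at hbc
      exact (substitute_mem ha hc).mpr (hQ.trans hab hbc)
    · rw [substitute_right hc] at hbc ⊢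
      exact ((hM c hc a ha b hb).2).mpr hbc
    · rw [substitute_right hb] at hab
      rw [substitute_left hb] at hbc
      exact absurd (((hM b hb a ha c hc).2).mp hab) (hP.asymm hbc)
    · rw [substitute_right hb] at hab
      rw [substitute_left hb] at hbc
      exact (substitute_right hc).mpr (hP.trans hab hbc)
    · rw [substitute_left ha] at hab ⊢
      exact ((hM a ha b hb c hc).1).mp hab
    · rw [substitute_left ha] at hab ⊢
      rw [substitute_right hc] at hbc
      exact hP.trans hab hbc
    · rw [substitute_left ha] at hab ⊢
      rw [substitute_left hb] at hbc
      exact hP.trans hab hbc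
    · rw [substitute_left ha] at hab ⊢
      rw [substitute_left hb] at hbc
      exact hP.trans hab hbc
  · intro a b hne hadj
    by_cases ha : a ∈ M
    · by_cases hb : b ∈ M
      · rw [substitute_mem ha hb, substitute_mem hb ha]
        exact hQ.total (fun h => hne (congrArg Subtype.val h)) hadj
      · rw [substitute_right hb, substitute_left hb]
        exact hP.total hne hadj
    · rw [substitute_left ha, substitute_right ha]
      exact hP.total hne hadj

/-- A sweep restricts to a sweep of every module. -/
theorem IsSweep.restrict (h : IsSweep G σ τ) {M : Set V} (hM : IsModule G M) :
    IsSweep (G.comap (Subtype.val : M → V)) (fun v => σ v) (fun v => τ v) where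
  inj a b hab := Subtype.ext (h.inj hab)
  lex {a b} hab := by
    rcases h.lex hab with ⟨c, hc, h1, h2, h3⟩ | ⟨h1, h2⟩
    · have hcM : c ∈ M := by
        by_contra hcM
        exact h2 ((hM c hcM a a.2 b b.2).mp h1)
      exact .inl ⟨⟨c, hcM⟩, hc, h1, h2, fun d hd => h3 d hd⟩
    · exact .inr ⟨fun c hc => h1 c hc, h2⟩

theorem IsIntervalOrder.restrict (hP : IsIntervalOrder G P) (M : Set V) :
    IsIntervalOrder (G.comap (Subtype.val : M → V)) (fun a b => P a b) where
  not_adj h := hP.not_adj h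
  asymm h := hP.asymm h
  trans h h' := hP.trans h h'
  total hne h := hP.total (fun h' => hne (Subtype.ext h')) h
  cross h h' := hP.cross h h'

/-! ### A bad vertex after a good prefix lies in a module -/

/-- Let `σ, τ, ρ` be consecutive sweeps, let `z` be the first vertex of `ρ` outside the good prefix
`E`, and suppose that some vertex outside `E` lies below `z`. Then `z` lies in a module `M` disjoint
from `E` that contains all these vertices.

Call a vertex outside `E` tied if it has the same neighbours in `E` as `z`, and let `x` be the first
vertex of `τ` that lies below `z` and outside `E`. The module consists of the tied vertices from `x`
on in `τ` that have the same neighbours as `z` in front of `x` in `τ`. A vertex outside `M` could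
distinguish members of `M` only if it is untied and comes after `x` in `τ`; this leads to a pair
`p, u` with `p` below `u` that `σ` orders wrongly and `τ` orders rightly. The hypotheses `hdisj` and
`hhom` exclude this: with `p` also `u` is in `E`, and if `p` is tied, then `u` has all neighbours of
`p` in `E`. They hold trivially for `E = ∅`, and by
`IsGoodPrefix.homogeneous` if `E` is contained in a good prefix of `σ`. -/
theorem exists_module_of_bad (hP : IsIntervalOrder G P) (hτ : IsSweep G σ τ) (hρ : IsSweep G τ ρ)
    {E : Set V} (hE : IsGoodPrefix P ρ E) {z y₀ : V} (hz : z ∉ E) (hzmin : ∀ w ∉ E, ρ z ≤ ρ w)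
    (hy₀ : y₀ ∉ E) (hy₀z : P y₀ z)
    (hdisj : ∀ p u, P p u → σ u < σ p → τ p < τ u → u ∉ E → p ∉ E)
    (hhom : ∀ p u, P p u → σ u < σ p → τ p < τ u → u ∉ E →
      (∀ e ∈ E, (G.Adj e p ↔ G.Adj e z)) → ∀ e ∈ E, G.Adj e p → G.Adj e u) :
    ∃ M : Set V, IsModule G M ∧ Disjoint M E ∧ z ∈ M ∧ (∀ y ∉ E, P y z → y ∈ M) ∧
      ∃ x ∈ M, P x z ∧ (M = Set.univ → ∀ w, τ x ≤ τ w) := by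
  have hlt : ∀ w ∉ E, w ≠ z → ρ z < ρ w := fun w hw hne =>
    lt_of_le_of_ne (hzmin w hw) fun h => hne (hρ.inj h).symm
  have hmem : ∀ c, ρ c < ρ z → c ∈ E := fun c hc => by
    by_contra h
    exact absurd (hzmin c h) (not_le.mpr hc)
  have hEz : ∀ e ∈ E, ρ e < ρ z := fun e he => hE.lt_of_mem hρ.inj he hz
  -- the vertices below `z` are tied with `z` when `z` is chosen
  have tied_of_below : ∀ y ∉ E, P y z → ∀ e ∈ E, (G.Adj e y ↔ G.Adj e z) := by
    intro y hy hyz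
    have h1 : ∀ e ∈ E, G.Adj e z → G.Adj e y := fun e he h => by
      by_contra h'
      exact hP.not_adj (hP.trans (hE.below hP hρ.inj he hy h') hyz) h
    refine fun e he => ⟨fun h => ?_, h1 e he⟩
    by_contra h'
    obtain ⟨d, hde, hdz, hdy, -⟩ :=
      hρ.exists_private (hlt y hy (hP.ne hyz)) (hEz e he) h h'
    exact hdy (h1 d (hE.lower he hde) hdz)
  have tied_lt : ∀ w ∉ E, w ≠ z → (∀ e ∈ E, (G.Adj e w ↔ G.Adj e z)) → τ w < τ z :=
    fun w hw hne h => (hρ.tie (hlt w hw hne) fun c hc hcz => (h c (hmem c hc)).mpr hcz).2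
  -- a vertex that is not tied with `z` misses a vertex of `E` that sees all tied vertices
  have untied : ∀ u ∉ E, ¬ (∀ e ∈ E, (G.Adj e u ↔ G.Adj e z)) →
      ∃ e ∈ E, G.Adj e z ∧ P e u := by
    intro u hu h
    by_contra! h'
    have h1 : ∀ e ∈ E, G.Adj e z → G.Adj e u := fun e he hez => by
      by_contra h2
      exact h' e he hez (hE.below hP hρ.inj he hu h2)
    have hne : u ≠ z := by rintro rfl; exact h fun _ _ => Iff.rfl
    refine h fun e he => ?_
    exact ((hρ.tie (hlt u hu hne) fun c hc hcz => h1 c (hmem c hc) hcz).1 e (hEz e he)).symm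
  obtain ⟨x, ⟨hxE, hxz⟩, hxmin⟩ := exists_first τ (fun y => y ∉ E ∧ P y z) ⟨y₀, hy₀, hy₀z⟩
  have hxtied := tied_of_below x hxE hxz
  have hτxz : τ x < τ z := tied_lt x hxE (hP.ne hxz) hxtied
  obtain ⟨hagree, -⟩ := hτ.tie hτxz fun c hc hcx => by
    by_contra hcz
    rcases hP.total (by rintro rfl; omega) hcz with h | h
    · by_cases hcE : c ∈ E
      · exact hcz ((hxtied c hcE).mp hcx)
      · exact absurd (hxmin c ⟨hcE, h⟩) (not_le.mpr hc)
    · exact hP.not_adj (hP.trans hxz h) hcx.symm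
  -- untied vertices are not adjacent to `x`
  have untied_not_adj : ∀ u ∉ E, ∀ e ∈ E, G.Adj e z → P e u → ¬ G.Adj u x := by
    intro u hu e he hez heu hux
    have huz : G.Adj u z := by
      by_contra h
      rcases hP.total (by rintro rfl; exact hP.not_adj heu hez) h with h | h
      · exact hP.not_adj (hP.trans heu h) hez
      · exact hP.not_adj (hP.trans hxz h) hux.symm
    exact hP.not_adj heu (hP.chord hux.symm huz hez.symm ((hxtied e he).mpr hez) hxz
      (by rintro rfl; exact hu he)).symm
  -- tied vertices that come after `x` in `τ` are tied with `x` in `τ`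
  have tied_after : ∀ w ∉ E, (∀ e ∈ E, (G.Adj e w ↔ G.Adj e z)) → τ x ≤ τ w →
      ∀ c, τ c < τ x → (G.Adj c w ↔ G.Adj c z) := by
    intro w hw hwt hxw
    rcases eq_or_ne w z with rfl | hne
    · exact fun _ _ => Iff.rfl
    rcases hxw.eq_or_lt with h | hxw
    · rw [← hτ.inj h]
      exact hagree
    · have hwz := tied_lt w hw hne hwt
      rcases hτ.lex hxw with ⟨c, hcx, h1, h2, h3⟩ | ⟨h1, -⟩
      · obtain ⟨d, hdc, hdw, hdz, -⟩ :=
          hτ.exists_private hwz (hcx.trans hxw) ((hagree c hcx).mp h1) h2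
        exact absurd ((hagree d (hdc.trans hcx)).mp ((h3 d hdc).mpr hdw)) hdz
      · exact fun c hc => (h1 c hc).symm.trans (hagree c hc)
  -- untied vertices that come after `x` in `τ` are not adjacent to the tied ones
  have untied_after : ∀ u ∉ E, ¬ (∀ e ∈ E, (G.Adj e u ↔ G.Adj e z)) → τ x ≤ τ u →
      ∀ w ∉ E, (∀ e ∈ E, (G.Adj e w ↔ G.Adj e z)) →
        (∀ c, τ c < τ x → (G.Adj c w ↔ G.Adj c z)) → ¬ G.Adj u w := by
    intro u hu hut hxu w hw hwt hwx huw
    obtain ⟨e, he, hez, heu⟩ := untied u hu hut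
    have hux := untied_not_adj u hu e he hez heu
    have hxune : x ≠ u := by
      rintro rfl
      exact hut hxtied
    have hPxu : P x u := hP.left (fun h => hux h.symm) hxune fun h =>
      hP.not_adj (hP.trans heu h) ((hxtied e he).mpr hez)
    have hxu : τ x < τ u := lt_of_le_of_ne hxu fun h => hxune (hτ.inj h)
    rcases hτ.lex hxu with ⟨p, hpx, h1, h2, -⟩ | ⟨-, h2⟩
    · have hPpu : P p u := hP.left h2 (by rintro rfl; omega) fun h =>
        hP.not_adj (hP.trans hPxu h) h1.symm
      obtain ⟨q, hqu, hqmin⟩ := exists_first τ (fun q => P q u) ⟨p, hPpu⟩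
      have hqx : τ q < τ x := (hqmin p hPpu).trans_lt hpx
      have hqlt : τ q < τ u := hqx.trans hxu
      have hσ : σ u < σ q := (hτ.tie hqlt fun c hc hcq => by
        by_contra hcu
        rcases hP.total (by rintro rfl; omega) hcu with h | h
        · exact absurd (hqmin c h) (not_le.mpr hc)
        · exact hP.not_adj (hP.trans hqu h) hcq.symm).2
      have hqE := hdisj q u hqu hσ hqlt hu
      by_cases hqt : ∀ e ∈ E, (G.Adj e q ↔ G.Adj e z)
      · exact hP.not_adj heu (hhom q u hqu hσ hqlt hu hqt e he ((hqt e he).mpr hez))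
      · obtain ⟨e', he', hez', heq⟩ := untied q hqE hqt
        have hqw : ¬ G.Adj q w := fun h => untied_not_adj q hqE e' he' hez' heq
          ((hagree q hqx).mpr ((hwx q hqx).mp h))
        rcases hP.total (by rintro rfl; exact hqt hwt) hqw with h | h
        · exact hP.not_adj (hP.trans heq h) ((hwt e' he').mpr hez')
        · exact hP.not_adj (hP.trans h hqu) huw.symm
    · exact hP.not_adj heu (hhom x u hPxu h2 hxu hu hxtied e he ((hxtied e he).mpr hez))
  refine ⟨{w | (w ∉ E ∧ ∀ e ∈ E, (G.Adj e w ↔ G.Adj e z)) ∧ τ x ≤ τ w ∧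
    ∀ c, τ c < τ x → (G.Adj c w ↔ G.Adj c z)}, ?_, ?_, ?_, ?_, x, ?_, hxz, ?_⟩
  · rintro c hc a ⟨⟨ha1, ha2⟩, ha3, ha4⟩ b ⟨⟨hb1, hb2⟩, hb3, hb4⟩
    by_cases hcE : c ∈ E
    · exact (ha2 c hcE).trans (hb2 c hcE).symm
    rcases lt_or_ge (τ c) (τ x) with hcx | hcx
    · exact (ha4 c hcx).trans (hb4 c hcx).symm
    by_cases hct : ∀ e ∈ E, (G.Adj e c ↔ G.Adj e z)
    · exact absurd ⟨⟨hcE, hct⟩, hcx, tied_after c hcE hct hcx⟩ hc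
    · exact iff_of_false (untied_after c hcE hct hcx a ha1 ha2 ha4)
        (untied_after c hcE hct hcx b hb1 hb2 hb4)
  · exact Set.disjoint_left.mpr fun a ha => ha.1.1
  · exact ⟨⟨hz, fun _ _ => Iff.rfl⟩, hτxz.le, fun _ _ => Iff.rfl⟩
  · exact fun y hy hyz => ⟨⟨hy, tied_of_below y hy hyz⟩, hxmin y ⟨hy, hyz⟩,
      tied_after y hy (tied_of_below y hy hyz) (hxmin y ⟨hy, hyz⟩)⟩
  · exact ⟨⟨hxE, hxtied⟩, le_rfl, hagree⟩
  · intro h w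
    exact ((Set.eq_univ_iff_forall.mp h) w).2.1

/-! ### Growth of the good prefix -/

variable {κ π : V → ℕ}

/-- The longest good prefix of `σ`. -/
def goodPart (P : V → V → Prop) (σ : V → ℕ) : Set V :=
  {v | ∀ w, σ w ≤ σ v → ∀ y, σ w < σ y → ¬ P y w}

theorem isGoodPrefix_goodPart : IsGoodPrefix P σ (goodPart P σ) where
  lower ha hb := fun w hw => ha w (hw.trans hb.le)
  good {a b} ha hb := ha a le_rfl b hb

theorem exists_bad (hσ : Function.Injective σ) {z : V} (hz : z ∉ goodPart P σ)
    (hmin : ∀ w ∉ goodPart P σ, σ z ≤ σ w) : ∃ y, y ∉ goodPart P σ ∧ σ z < σ y ∧ P y z := by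
  simp only [goodPart, Set.mem_ofPred_eq, not_forall, not_not] at hz
  obtain ⟨w, hwz, y, hwy, hy⟩ := hz
  have hw : w ∉ goodPart P σ := fun h => h w le_rfl y hwy hy
  obtain rfl : w = z := hσ (le_antisymm hwz (hmin w hw))
  exact ⟨y, fun h => hw (isGoodPrefix_goodPart.lower h hwy), hwy, hy⟩

/-- Every proper homogeneous module starts, in the ordering `ρ`, with a `P`-minimal vertex. -/
def StartsRight (G : SimpleGraph V) (P : V → V → Prop) (ρ : V → ℕ) : Prop :=
  ∀ M : Set V, IsModule G M → M ≠ Set.univ → IsHomogeneous P M →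
    ∀ z ∈ M, (∀ w ∈ M, ρ z ≤ ρ w) → ∀ y ∈ M, ¬ P y z

/-- The module of `exists_module_of_bad` contradicts `StartsRight`. -/
theorem StartsRight.not_bad (hmod : StartsRight G P ρ) (hP : IsIntervalOrder G P)
    (hτ : IsSweep G σ τ) (hρ : IsSweep G τ ρ) {E : Set V} (hE : IsGoodPrefix P ρ E)
    (hne : E.Nonempty) {z : V} (hz : z ∉ E) (hzmin : ∀ w ∉ E, ρ z ≤ ρ w)
    (hdisj : ∀ p u, P p u → σ u < σ p → τ p < τ u → u ∉ E → p ∉ E)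
    (hhom : ∀ p u, P p u → σ u < σ p → τ p < τ u → u ∉ E →
      (∀ e ∈ E, (G.Adj e p ↔ G.Adj e z)) → ∀ e ∈ E, G.Adj e p → G.Adj e u)
    {y : V} (hy : y ∉ E) : ¬ P y z := by
  intro hyz
  obtain ⟨M, hM, hME, hzM, -, x, hxM, hxz, -⟩ :=
    exists_module_of_bad hP hτ hρ hE hz hzmin hy hyz hdisj hhom
  have hdis : ∀ c ∈ hull P M, c ∉ E := by
    rintro c (hc | ⟨a, ha, b, hb, hac, hcb⟩) hcE
    · exact Set.disjoint_left.mp hME hc hcE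
    · exact hE.not_below hρ.inj hcE (Set.disjoint_left.mp hME ha) hac
  refine hmod (hull P M) (hM.hull hP ⟨z, hzM⟩) ?_ (hM.isHomogeneous_hull hP ⟨z, hzM⟩) z
    (subset_hull M hzM) (fun w hw => hzmin w (hdis w hw)) x (subset_hull M hxM) hxz
  intro h
  obtain ⟨e, he⟩ := hne
  exact hdis e (h ▸ Set.mem_univ e) he

/-- The good part of `ρ`, unless it is everything, is not contained in that of `σ`. -/
theorem StartsRight.not_subset (hmod : StartsRight G P ρ) (hP : IsIntervalOrder G P)
    (hσ : IsSweep G π σ) (hτ : IsSweep G σ τ) (hρ : IsSweep G τ ρ)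
    (hne : (goodPart P ρ).Nonempty) (huniv : goodPart P ρ ≠ Set.univ) :
    ¬ goodPart P ρ ⊆ goodPart P σ := by
  intro hsub
  obtain ⟨z, hz, hzmin⟩ := exists_first ρ (fun v => v ∉ goodPart P ρ)
    ((Set.ne_univ_iff_exists_notMem _).mp huniv)
  obtain ⟨y, hy, -, hyz⟩ := exists_bad hρ.inj hz hzmin
  have hD := isGoodPrefix_goodPart (P := P) (σ := σ)
  refine hmod.not_bad hP hτ hρ isGoodPrefix_goodPart hne hz hzmin ?_ ?_ hy hyz
  · exact fun p u hpu hup _ _ h => (hD.homogeneous hP hσ hpu hup).2.1 (hsub h)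
  · exact fun p u hpu hup _ _ _ e he h => ((hD.homogeneous hP hσ hpu hup).2.2 e (hsub he)).mp h

/-- If `v` is the first vertex of `ρ` outside the good part `D` of `σ` and `v` is itself in the
good part of `ρ`, then `ρ` starts with the vertices of `D`. Otherwise `ρ` leaves `D` at `v` while
some vertex `d` of `D` is not yet numbered. Then `d` and `v` are adjacent and tied, both in `ρ` and
in `σ`. Let `z` be the first vertex of `σ` outside `D`, with `y` below it. If `v` is adjacent to
`z`, then `y` and `z` are nonadjacent neighbours of `v` in front of it in `τ`; otherwise `v` and
`z` are nonadjacent neighbours of `d` in front of it in `π`. Both contradict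
`IsSweep.adj_of_earlier`. -/
theorem goodPart_lt (hP : IsIntervalOrder G P) (hπ : IsSweep G κ π)
    (hσ : IsSweep G π σ) (hτ : IsSweep G σ τ) (hρ : IsSweep G τ ρ) {v : V}
    (hvD : v ∉ goodPart P σ) (hvmin : ∀ w ∉ goodPart P σ, ρ v ≤ ρ w) (hvE : v ∈ goodPart P ρ)
    {d : V} (hd : d ∈ goodPart P σ) : ρ d < ρ v := by
  have hD := isGoodPrefix_goodPart (P := P) (σ := σ)
  have hE := isGoodPrefix_goodPart (P := P) (σ := ρ)
  have hmem : ∀ c, ρ c < ρ v → c ∈ goodPart P σ := fun c hc => by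
    by_contra h
    exact absurd (hvmin c h) (not_le.mpr hc)
  -- what lies below `v` is numbered before `v`
  have hbelow : ∀ a, P a v → ρ a < ρ v := fun a ha => by
    rcases lt_trichotomy (ρ a) (ρ v) with h | h | h
    · exact h
    · exact absurd (hρ.inj h) (hP.ne ha)
    · exact absurd ha (hE.good hvE h)
  have hPv : ∀ a ∉ goodPart P σ, ¬ P a v := fun a ha h => ha (hmem a (hbelow a h))
  by_contra hdv
  obtain ⟨d, ⟨hd, hdv⟩, hdmin⟩ :=
    exists_first σ (fun d => d ∈ goodPart P σ ∧ ¬ ρ d < ρ v) ⟨d, hd, hdv⟩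
  have hdvne : d ≠ v := by rintro rfl; exact hvD hd
  have hρvd : ρ v < ρ d := lt_of_le_of_ne (not_lt.mp hdv) fun h => hdvne (hρ.inj h).symm
  have hσmem : ∀ c, σ c < σ d → ρ c < ρ v := fun c hc => by
    by_contra h
    exact absurd (hdmin c ⟨hD.lower hd hc, h⟩) (not_le.mpr hc)
  have hadj : G.Adj d v := by
    by_contra h
    exact hdv (hbelow d (hD.below hP hσ.inj hd hvD h))
  -- `d` and `v` are tied when `v` is chosen in `ρ`
  have hqd : ∀ q, ρ q < ρ v → ¬ G.Adj q d → P q d := fun q hq h =>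
    hP.left h (by rintro rfl; omega) (hE.good (hE.lower hvE hq) (hq.trans hρvd))
  have hqv : ∀ q, ρ q < ρ v → ¬ G.Adj q v → P q v := fun q hq h =>
    hD.below hP hσ.inj (hmem q hq) hvD h
  have hcross : ∀ q q', ρ q < ρ v → ρ q' < ρ v → G.Adj q v → ¬ G.Adj q d → G.Adj q' d →
      G.Adj q' v := by
    intro q q' hq hq' h1 h2 h3
    by_contra h4
    rcases hP.cross (hqd q hq h2) (hqv q' hq' h4) with h | h
    · exact hP.not_adj h h1
    · exact hP.not_adj h h3
  have htied : ∀ q, ρ q < ρ v → (G.Adj q d ↔ G.Adj q v) := by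
    intro q hq
    constructor
    · intro h1
      by_contra h2
      obtain ⟨q', hq', h3, h4, -⟩ := hρ.exists_private hρvd hq h1 h2
      exact h2 (hcross q' q (hq'.trans hq) hq h3 h4 h1)
    · intro h1
      by_contra h2
      have hσqd : σ q < σ d := by
        rcases lt_trichotomy (σ q) (σ d) with h | h | h
        · exact h
        · exact absurd (hσ.inj h) (hP.ne (hqd q hq h2))
        · exact absurd (hqd q hq h2) (hD.good hd h)
      obtain ⟨q', hq', h3, h4, -⟩ :=
        hσ.exists_private (hD.lt_of_mem hσ.inj hd hvD) hσqd h1 h2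
      exact h4 (hcross q q' hq (hσmem q' (hq'.trans hσqd)) h1 h2 h3)
  -- the first bad vertex of `σ`
  obtain ⟨z, hz, hzmin⟩ := exists_first σ (fun w => w ∉ goodPart P σ) ⟨v, hvD⟩
  obtain ⟨y, hy, hzy, hyz⟩ := exists_bad hσ.inj hz hzmin
  have hyzhom := (hD.homogeneous hP hσ hyz hzy).2.2
  have hvz : v ≠ z := by rintro rfl; exact hPv y hy hyz
  have hσzv : σ z < σ v := lt_of_le_of_ne (hzmin v hvD) fun h => hvz (hσ.inj h).symm
  have hsub : ∀ q ∈ goodPart P σ, G.Adj q v → G.Adj q z := by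
    intro q hq h1
    by_contra h2
    obtain ⟨q', hq', h3, h4, -⟩ :=
      hσ.exists_private hσzv (hD.lt_of_mem hσ.inj hq hz) h1 h2
    exact h4 (hD.nested hP hσ.inj hvD hz hq (hD.lower hq hq') h1 h2 h3)
  have hPvz : ¬ G.Adj v z := by
    intro hvz'
    have hvy : G.Adj v y := by
      by_contra h
      rcases hP.total (by rintro rfl; exact hP.not_adj hyz hvz') h with h | h
      · exact hP.not_adj (hP.trans h hyz) hvz'
      · exact hPv y hy h
    have hvρ : ∀ w ∉ goodPart P σ, w ≠ v → ρ v < ρ w := fun w hw hne =>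
      lt_of_le_of_ne (hvmin w hw) fun h => hne (hρ.inj h).symm
    have h1 := (hρ.tie (hvρ y hy hvy.ne') fun c hc hcv =>
      (hyzhom c (hmem c hc)).mpr (hsub c (hmem c hc) hcv)).2
    have h2 := (hρ.tie (hvρ z hz hvz.symm) fun c hc hcv => hsub c (hmem c hc) hcv).2
    exact hP.not_adj hyz (hτ.adj_of_earlier hP h1 h2 hvy.symm hvz'.symm (hP.ne hyz))
  have h1 := (hσ.tie (hD.lt_of_mem hσ.inj hd hvD) fun c hc hcd =>
    (htied c (hσmem c hc)).mp hcd).2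
  have h2 := (hσ.tie (hD.lt_of_mem hσ.inj hd hz) fun c hc hcd =>
    hsub c (hD.lower hd hc) ((htied c (hσmem c hc)).mp hcd)).2
  exact hPvz (hπ.adj_of_earlier hP h1 h2 hadj.symm (hsub d hd hadj).symm hvz)

/-- If `ρ` starts with the good part `D` of `σ` followed by a vertex `v`, and `D` together with `v`
is a good prefix of `ρ`, then the next vertex of `ρ` is good as well. The module argument of
`StartsRight.not_bad` still applies to the enlarged prefix, because `v` is not adjacent to the next
vertex `z` if something lies below `z`. -/
theorem StartsRight.good_after_insert (hmod : StartsRight G P ρ) (hP : IsIntervalOrder G P)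
    (hσ : IsSweep G π σ) (hτ : IsSweep G σ τ) (hρ : IsSweep G τ ρ) {v z : V}
    (hvD : v ∉ goodPart P σ) (hvmin : ∀ w ∉ goodPart P σ, ρ v ≤ ρ w)
    (hDv : ∀ d ∈ goodPart P σ, ρ d < ρ v)
    (hE : IsGoodPrefix P ρ (insert v (goodPart P σ))) (hz : z ∉ insert v (goodPart P σ))
    (hzmin : ∀ w ∉ insert v (goodPart P σ), ρ z ≤ ρ w) {y : V}
    (hy : y ∉ insert v (goodPart P σ)) : ¬ P y z := by
  intro hyz
  have hD := isGoodPrefix_goodPart (P := P) (σ := σ)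
  have hvρ : ∀ w ∉ goodPart P σ, w ≠ v → ρ v < ρ w := fun w hw hne =>
    lt_of_le_of_ne (hvmin w hw) fun h => hne (hρ.inj h).symm
  have hmem : ∀ c, ρ c < ρ v → c ∈ goodPart P σ := fun c hc => by
    by_contra h
    exact absurd (hvmin c h) (not_le.mpr hc)
  have hzD : z ∉ goodPart P σ := fun h => hz (Set.mem_insert_of_mem v h)
  have hyD : y ∉ goodPart P σ := fun h => hy (Set.mem_insert_of_mem v h)
  have hvz : z ≠ v := fun h => hz (h ▸ Set.mem_insert _ _)
  have hvy : y ≠ v := fun h => hy (h ▸ Set.mem_insert _ _)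
  have hnot : ¬ G.Adj v z := by
    intro hvz'
    have hvy' : G.Adj v y := by
      by_contra h
      exact hP.not_adj (hP.trans (hE.below hP hρ.inj (Set.mem_insert _ _) hy h) hyz) hvz'
    have hzy : ∀ c ∈ goodPart P σ, G.Adj c z → G.Adj c y := fun c hc h => by
      by_contra h'
      exact hP.not_adj (hP.trans (hE.below hP hρ.inj (Set.mem_insert_of_mem v hc) hy h') hyz) h
    rcases hρ.lex (hvρ z hzD hvz) with ⟨c, hcv, h1, h2, h3⟩ | ⟨h1, h2⟩
    · -- the label of `v` is strictly larger than all others, so `v` also follows `D` in `σ`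
      obtain ⟨z', hz', hzmin'⟩ := exists_first σ (fun w => w ∉ goodPart P σ) ⟨v, hvD⟩
      obtain ⟨y', hy', -, hyz'⟩ := exists_bad hσ.inj hz' hzmin'
      have hne : z' ≠ v := by
        rintro rfl
        refine hE.not_below hρ.inj (Set.mem_insert _ _) ?_ hyz'
        rintro (h | h)
        · exact hP.ne hyz' h
        · exact hy' h
      have hz'E : z' ∉ insert v (goodPart P σ) := by
        rintro (h | h)
        · exact hne h
        · exact hz' h
      obtain ⟨c', hc', h4, h5⟩ : ∃ c' ∈ goodPart P σ, G.Adj c' v ∧ ¬ G.Adj c' z' := by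
        by_contra! h
        rcases eq_or_ne z' z with rfl | hne'
        · exact h2 (h c (hmem c hcv) h1)
        · obtain ⟨d, hdc, h6, h7, -⟩ := hρ.exists_private
            (lt_of_le_of_ne (hzmin z' hz'E) fun h => hne' (hρ.inj h).symm)
            (hcv.trans (hvρ z hzD hvz)) (h c (hmem c hcv) h1) h2
          exact h7 (h d (hmem d (hdc.trans hcv)) ((h3 d hdc).mpr h6))
      have hlt : σ z' < σ v := lt_of_le_of_ne (hzmin' v hvD) fun h => hne (hσ.inj h)
      obtain ⟨d, hdc, h6, h7, -⟩ :=
        hσ.exists_private hlt (hD.lt_of_mem hσ.inj hc' hz') h4 h5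
      exact h7 (hD.nested hP hσ.inj hvD hz' hc' (hD.lower hc' hdc) h4 h5 h6)
    · have h3 := (hρ.tie (hvρ y hyD hvy) fun c hc hcv =>
        hzy c (hmem c hc) ((h1 c hc).mp hcv)).2
      exact hP.not_adj hyz (hτ.adj_of_earlier hP h3 h2 hvy'.symm hvz'.symm (hP.ne hyz))
  refine hmod.not_bad hP hτ hρ hE ⟨v, Set.mem_insert _ _⟩ hz hzmin ?_ ?_ hy hyz
  · rintro p u hpu hup hτpu hu (rfl | hp)
    · have hu' : u ∉ goodPart P σ := fun h => hu (Set.mem_insert_of_mem _ h)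
      have h := (hρ.tie (hvρ u hu' (hP.ne hpu).symm) fun c hc hcp =>
        ((hD.homogeneous hP hσ hpu hup).2.2 c (hmem c hc)).mp hcp).2
      exact lt_asymm h hτpu
    · exact (hD.homogeneous hP hσ hpu hup).2.1 hp
  · rintro p u hpu hup - - htied e (rfl | he) hep
    · exact absurd ((htied e (Set.mem_insert _ _)).mp hep) hnot
    · exact ((hD.homogeneous hP hσ hpu hup).2.2 e he).mp hep

/-- In two sweeps the good part grows by at least two vertices, until it contains all vertices. -/
theorem StartsRight.ncard_goodPart [Finite V] (hmod : StartsRight G P ρ)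
    (hP : IsIntervalOrder G P) (hπ : IsSweep G κ π) (hσ : IsSweep G π σ) (hτ : IsSweep G σ τ)
    (hρ : IsSweep G τ ρ) (hne : (goodPart P ρ).Nonempty) (huniv : goodPart P ρ ≠ Set.univ) :
    (goodPart P σ).ncard + 2 ≤ (goodPart P ρ).ncard := by
  have hE := isGoodPrefix_goodPart (P := P) (σ := ρ)
  obtain ⟨w, hwE, hwD⟩ := Set.not_subset.mp (hmod.not_subset hP hσ hτ hρ hne huniv)
  obtain ⟨v, hvD, hvmin⟩ := exists_first ρ (fun v => v ∉ goodPart P σ) ⟨w, hwD⟩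
  have hvE : v ∈ goodPart P ρ := by
    rcases (hvmin w hwD).eq_or_lt with h | h
    · exact hρ.inj h ▸ hwE
    · exact hE.lower hwE h
  have hDv : ∀ d ∈ goodPart P σ, ρ d < ρ v := fun d hd =>
    goodPart_lt hP hπ hσ hτ hρ hvD hvmin hvE hd
  have hsub : insert v (goodPart P σ) ⊆ goodPart P ρ := by
    rintro d (rfl | hd)
    · exact hvE
    · exact hE.lower hvE (hDv d hd)
  have hssub : insert v (goodPart P σ) ⊂ goodPart P ρ := by
    refine hsub.ssubset_of_ne fun heq => ?_
    obtain ⟨z, hz, hzmin⟩ := exists_first ρ (fun v => v ∉ goodPart P ρ)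
      ((Set.ne_univ_iff_exists_notMem _).mp huniv)
    obtain ⟨y, hy, -, hyz⟩ := exists_bad hρ.inj hz hzmin
    rw [← heq] at hz hy hE
    exact hmod.good_after_insert hP hσ hτ hρ hvD hvmin hDv hE hz
      (fun w hw => hzmin w (heq ▸ hw)) hy hyz
  have h1 := Set.ncard_lt_ncard hssub
  rw [Set.ncard_insert_of_notMem hvD] at h1
  omega

/-! ### Limit orders -/

/-- The relation `P` for even `i`, and its reverse for odd `i`. -/
def alternate (P : V → V → Prop) (i : ℕ) (a b : V) : Prop :=
  if Even i then P a b else P b a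

variable {i : ℕ} {s : ℕ → V → ℕ}

theorem alternate_even (h : Even i) : alternate P i = P := by
  funext a b
  simp [alternate, h]

theorem alternate_odd (h : ¬ Even i) : alternate P i = fun a b => P b a := by
  funext a b
  simp [alternate, h]

theorem alternate_succ {a b : V} : alternate P (i + 1) a b ↔ alternate P i b a := by
  by_cases h : Even i <;> simp [alternate, h, Nat.even_add_one]

theorem alternate_add_two : alternate P (i + 2) = alternate P i := by
  funext a b
  exact propext (alternate_succ.trans alternate_succ)

theorem IsIntervalOrder.alternate (hP : IsIntervalOrder G P) (i : ℕ) :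
    IsIntervalOrder G (alternate P i) := by
  by_cases h : Even i
  · rw [alternate_even h]
    exact hP
  · rw [alternate_odd h]
    exact hP.swap

theorem IsHomogeneous.of_alternate {M : Set V} (h : IsHomogeneous (LexBFS.alternate P i) M) :
    IsHomogeneous P M := by
  by_cases hi : Even i
  · rwa [alternate_even hi] at h
  · rw [alternate_odd hi] at h
    exact h.swap

/-- `P` is the order to which the orderings `s i` converge: for `i ≥ 2` the first vertex of `s i`
is minimal, and from `i = |V|` on the whole ordering `s i` agrees with `P`; for odd `i` the order
`P` has to be reversed. The bound in `first` does not depend on `V`, so that the property passes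
from modules to the whole graph. -/
structure IsLimit (G : SimpleGraph V) (s : ℕ → V → ℕ) (P : V → V → Prop) : Prop where
  order : IsIntervalOrder G P
  first : ∀ i, 2 ≤ i → ∀ z, (∀ w, s i z ≤ s i w) → ∀ y, ¬ LexBFS.alternate P i y z
  agrees : ∀ i, Nat.card V ≤ i → ∀ a b, s i a < s i b → ¬ LexBFS.alternate P i b a

/-! ### Disconnected graphs -/

/-- A sweep reverses the order of two unions of components that are separated in `σ`. -/
theorem IsSweep.reverse_blocks (h : IsSweep G σ τ) {A : Set V}
    (hA : ∀ a ∈ A, ∀ b ∉ A, ¬ G.Adj b a) (hσ : ∀ a ∈ A, ∀ b ∉ A, σ a < σ b) :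
    ∀ a ∈ A, ∀ b ∉ A, τ b < τ a := by
  intro a ha b hb
  by_contra hlt
  obtain ⟨c, hc, hcmin⟩ := exists_first τ (· ∈ A) ⟨a, ha⟩
  have hcb : τ c < τ b := lt_of_le_of_ne ((hcmin a ha).trans (not_lt.mp hlt)) fun h' =>
    hb (h.inj h' ▸ hc)
  refine lt_asymm (hσ c hc b hb) (h.tie hcb fun d hd hdc => ?_).2
  by_cases hdA : d ∈ A
  · exact absurd (hcmin d hdA) (not_le.mpr hd)
  · exact absurd hdc (hA c hc d hdA)

/-- A sweep visits the component of its first vertex before all other vertices. -/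
theorem IsSweep.component_first (h : IsSweep G σ τ) {e : V} (he : ∀ w, τ e ≤ τ w) {a b : V}
    (ha : G.Reachable e a) (hb : ¬ G.Reachable e b) : τ a < τ b := by
  by_contra hlt
  obtain ⟨r, hr, hrmin⟩ := exists_first τ (fun r => ¬ G.Reachable e r) ⟨b, hb⟩
  have hra : τ r < τ a := lt_of_le_of_ne ((hrmin b hb).trans (not_lt.mp hlt)) fun h' =>
    hr (h.inj h' ▸ ha)
  have her : τ e < τ r := lt_of_le_of_ne (he r) fun h' =>
    hr (h.inj h' ▸ SimpleGraph.Reachable.refl e)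
  have hnone : ∀ c, τ c < τ r → ¬ G.Adj c r := fun c hc hcr => by
    have hc' : G.Reachable e c := by
      by_contra h'
      exact absurd (hrmin c h') (not_le.mpr hc)
    exact hr (hc'.trans hcr.reachable)
  obtain ⟨p⟩ := ha
  obtain ⟨d, -, hd1, hd2⟩ := p.exists_boundary_dart {v | τ v < τ r} her (by simpa using hra.le)
  have hd1' : τ d.fst < τ r := hd1
  have hd2' : τ r ≤ τ d.snd := not_lt.mp hd2
  rcases hd2'.eq_or_lt with h' | h'
  · exact hnone _ hd1' (h.inj h' ▸ d.adj)
  · exact hnone _ hd1' (((h.tie h' fun c hc hcr => absurd hcr (hnone c hc)).1 _ hd1').mpr d.adj)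

/-- On a disconnected graph a limit order is obtained by putting the component visited first by
`s 2` below all other vertices. -/
theorem exists_isLimit_of_disconnected [Finite V] {P₀ : V → V → Prop}
    (hP₀ : IsIntervalOrder G P₀) (hs : ∀ i, IsSweep G (s i) (s (i + 1))) {e : V}
    (he : ∀ w, s 2 e ≤ s 2 w) {C : Set V} (hC : ∀ v, v ∈ C ↔ G.Reachable e v)
    (hCuniv : C ≠ Set.univ)
    {P₁ : C → C → Prop} (h₁ : IsLimit (G.comap Subtype.val) (fun i (v : C) => s i v) P₁)
    {P₂ : (Cᶜ : Set V) → (Cᶜ : Set V) → Prop}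
    (h₂ : IsLimit (G.comap Subtype.val) (fun i (v : (Cᶜ : Set V)) => s i v) P₂) :
    ∃ P, IsLimit G s P := by
  have hnadj : ∀ a ∈ C, ∀ b ∉ C, ¬ G.Adj b a := fun a ha b hb h =>
    hb ((hC b).mpr (((hC a).mp ha).trans h.symm.reachable))
  have horder : ∀ i, 2 ≤ i → ∀ a ∈ C, ∀ b ∉ C,
      if Even i then s i a < s i b else s i b < s i a := by
    intro i hi
    induction i, hi using Nat.le_induction with
    | base =>
      intro a ha b hb
      exact (hs 1).component_first he ((hC a).mp ha) fun h => hb ((hC b).mpr h)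
    | succ i hi ih =>
      by_cases h : Even i
      · simp only [h, if_true] at ih
        simp only [Nat.even_add_one, h, not_true, if_false]
        exact (hs i).reverse_blocks hnadj ih
      · simp only [h, if_false] at ih
        simp only [Nat.even_add_one, h, not_false_iff, if_true]
        intro a ha b hb
        exact (hs i).reverse_blocks (A := Cᶜ)
          (fun a ha b hb h => hnadj b (not_not.mp hb) a ha h.symm)
          (fun a ha b hb => ih b (not_not.mp hb) a ha) b hb a (not_not.mpr ha)
  have heC : e ∈ C := (hC e).mpr (SimpleGraph.Reachable.refl e)
  obtain ⟨r, hr⟩ := (Set.ne_univ_iff_exists_notMem _).mp hCuniv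
  have hcard : 2 ≤ Nat.card V := by
    have : 1 < Nat.card V := Finite.one_lt_card_iff_nontrivial.mpr ⟨e, r, fun h => hr (h ▸ heC)⟩
    exact this
  let Q : V → V → Prop := fun a b => (∃ ha hb, P₁ ⟨a, ha⟩ ⟨b, hb⟩) ∨ (∃ ha hb, P₂ ⟨a, ha⟩ ⟨b, hb⟩) ∨
    (a ∈ C ∧ b ∉ C)
  have hQ₁ : ∀ {a b} (ha : a ∈ C) (hb : b ∈ C), Q a b ↔ P₁ ⟨a, ha⟩ ⟨b, hb⟩ := by
    intro a b ha hb
    simp [Q, ha, hb]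
  have hQ₂ : ∀ {a b} (ha : a ∉ C) (hb : b ∉ C), Q a b ↔ P₂ ⟨a, ha⟩ ⟨b, hb⟩ := by
    intro a b ha hb
    simp [Q, ha, hb]
  have hQ₃ : ∀ {a b}, a ∈ C → b ∉ C → Q a b := fun ha hb => .inr (.inr ⟨ha, hb⟩)
  have hQ₄ : ∀ {a b}, a ∉ C → b ∈ C → ¬ Q a b := by
    intro a b ha hb
    simp [Q, ha, hb]
  have hQ : IsIntervalOrder G Q := by
    refine hP₀.of_trans ?_ ?_ ?_ ?_
    · intro a b h
      by_cases ha : a ∈ C <;> by_cases hb : b ∈ C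
      · exact h₁.order.not_adj ((hQ₁ ha hb).mp h)
      · exact fun h' => hnadj a ha b hb h'.symm
      · exact absurd h (hQ₄ ha hb)
      · exact h₂.order.not_adj ((hQ₂ ha hb).mp h)
    · intro a b h h'
      by_cases ha : a ∈ C <;> by_cases hb : b ∈ C
      · exact h₁.order.asymm ((hQ₁ ha hb).mp h) ((hQ₁ hb ha).mp h')
      · exact hQ₄ hb ha h'
      · exact hQ₄ ha hb h
      · exact h₂.order.asymm ((hQ₂ ha hb).mp h) ((hQ₂ hb ha).mp h')
    · intro a b c h h'
      by_cases ha : a ∈ C <;> by_cases hb : b ∈ C <;> by_cases hc : c ∈ C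
      · exact (hQ₁ ha hc).mpr (h₁.order.trans ((hQ₁ ha hb).mp h) ((hQ₁ hb hc).mp h'))
      · exact hQ₃ ha hc
      · exact absurd h' (hQ₄ hb hc)
      · exact hQ₃ ha hc
      · exact absurd h (hQ₄ ha hb)
      · exact absurd h (hQ₄ ha hb)
      · exact absurd h' (hQ₄ hb hc)
      · exact (hQ₂ ha hc).mpr (h₂.order.trans ((hQ₂ ha hb).mp h) ((hQ₂ hb hc).mp h'))
    · intro a b hne h
      by_cases ha : a ∈ C <;> by_cases hb : b ∈ C
      · rw [hQ₁ ha hb, hQ₁ hb ha]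
        exact h₁.order.total (fun h' => hne (congrArg Subtype.val h')) h
      · exact .inl (hQ₃ ha hb)
      · exact .inr (hQ₃ hb ha)
      · rw [hQ₂ ha hb, hQ₂ hb ha]
        exact h₂.order.total (fun h' => hne (congrArg Subtype.val h')) h
  -- pairs from different sides are in the right order from the second sweep on
  have hmixed : ∀ i, 2 ≤ i → ∀ a b, alternate Q i a b → (a ∈ C ↔ b ∉ C) → s i a < s i b := by
    intro i hi a b h hab
    have h' := horder i hi
    by_cases hev : Even i
    · simp only [hev, if_true] at h'
      rw [alternate_even hev] at h
      by_cases ha : a ∈ C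
      · exact h' a ha b (hab.mp ha)
      · exact absurd h (hQ₄ ha (not_not.mp (mt hab.mpr ha)))
    · simp only [hev, if_false] at h'
      rw [alternate_odd hev] at h
      by_cases ha : a ∈ C
      · exact absurd h (hQ₄ (hab.mp ha) ha)
      · exact h' b (not_not.mp (mt hab.mpr ha)) a ha
  have halt₁ : ∀ i {a b} (ha : a ∈ C) (hb : b ∈ C), alternate Q i a b →
      alternate P₁ i ⟨a, ha⟩ ⟨b, hb⟩ := by
    intro i a b ha hb h
    unfold alternate at h ⊢
    split_ifs at h ⊢
    · exact (hQ₁ ha hb).mp h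
    · exact (hQ₁ hb ha).mp h
  have halt₂ : ∀ i {a b} (ha : a ∉ C) (hb : b ∉ C), alternate Q i a b →
      alternate P₂ i ⟨a, ha⟩ ⟨b, hb⟩ := by
    intro i a b ha hb h
    unfold alternate at h ⊢
    split_ifs at h ⊢
    · exact (hQ₂ ha hb).mp h
    · exact (hQ₂ hb ha).mp h
  refine ⟨Q, hQ, fun i hi z hz y h => ?_, fun i hi a b hab h => ?_⟩
  · by_cases hzC : z ∈ C <;> by_cases hyC : y ∈ C
    · exact h₁.first i hi ⟨z, hzC⟩ (fun w => hz w) _ (halt₁ i hyC hzC h)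
    · exact absurd (hz y) (not_le.mpr (hmixed i hi y z h (by tauto)))
    · exact absurd (hz y) (not_le.mpr (hmixed i hi y z h (by tauto)))
    · exact h₂.first i hi ⟨z, hzC⟩ (fun w => hz w) _ (halt₂ i hyC hzC h)
  · by_cases haC : a ∈ C <;> by_cases hbC : b ∈ C
    · exact h₁.agrees i ((Finite.card_subtype_le _).trans hi) ⟨a, haC⟩ ⟨b, hbC⟩ hab
        (halt₁ i hbC haC h)
    · exact lt_asymm hab (hmixed i (hcard.trans hi) b a h (by tauto))
    · exact lt_asymm hab (hmixed i (hcard.trans hi) b a h (by tauto))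
    · exact h₂.agrees i ((Finite.card_subtype_le _).trans hi) ⟨a, haC⟩ ⟨b, hbC⟩ hab
        (halt₂ i hbC haC h)

/-! ### Connected graphs -/

/-- If the first vertex `z` of `ρ` is not minimal in `P`, then the first vertex of `τ` is below `z`
or `z` lies, together with everything below it, in a proper homogeneous module. -/
theorem IsIntervalOrder.below_or_module (hP : IsIntervalOrder G P)
    (hconn : ∀ A : Set V, A.Nonempty → A ≠ Set.univ → ∃ a ∈ A, ∃ b ∉ A, G.Adj a b)
    (hτ : IsSweep G σ τ) (hρ : IsSweep G τ ρ) {z y : V} (hz : ∀ w, ρ z ≤ ρ w) (hyz : P y z) :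
    (∃ x, P x z ∧ ∀ w, τ x ≤ τ w) ∨
    ∃ M : Set V, IsModule G M ∧ M ≠ Set.univ ∧ IsHomogeneous P M ∧ z ∈ M ∧
      (∀ y, P y z → y ∈ M) ∧ ∃ x ∈ M, P x z := by
  obtain ⟨M, hM, -, hzM, hyM, x, hxM, hxz, hx⟩ := exists_module_of_bad hP hτ hρ
    (isGoodPrefix_empty (P := P) (σ := ρ)) (Set.notMem_empty z) (fun w _ => hz w)
    (Set.notMem_empty y) hyz (by simp) (by simp)
  by_cases hMu : M = Set.univ
  · exact .inl ⟨x, hxz, hx hMu⟩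
  · refine .inr ⟨hull P M, hM.hull hP ⟨z, hzM⟩, fun hu => ?_,
      hM.isHomogeneous_hull hP ⟨z, hzM⟩, subset_hull M hzM,
      fun y hy => subset_hull M (hyM y (Set.notMem_empty y) hy), x, subset_hull M hxM, hxz⟩
    obtain ⟨a, ha, b, hb, hab⟩ := hconn M ⟨z, hzM⟩ hMu
    rcases hu ▸ Set.mem_univ b with h | ⟨c, hc, -, -, hcb, -⟩
    · exact hb h
    · exact hP.not_adj hcb ((hM b hb a ha c hc).mp hab.symm).symm

/-- Some interval order has the first vertex of the second sweep as a minimal element. If neither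
`P` nor its reverse can be corrected inside a module, the first vertex of the first sweep is both
below and above that vertex. -/
theorem exists_minimal_first (hP : IsIntervalOrder G P)
    (hconn : ∀ A : Set V, A.Nonempty → A ≠ Set.univ → ∃ a ∈ A, ∃ b ∉ A, G.Adj a b)
    (hs : ∀ i, IsSweep G (s i) (s (i + 1)))
    (ih : ∀ M : Set V, IsModule G M → M ≠ Set.univ →
      ∃ Q, IsLimit (G.comap (Subtype.val : M → V)) (fun i v => s i v) Q)
    {z : V} (hz : ∀ w, s 2 z ≤ s 2 w) : ∃ P, IsIntervalOrder G P ∧ ∀ y, ¬ P y z := by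
  -- either `P'` can be corrected in a module, or `z` is above the first vertex of `s 1`
  have key : ∀ P' : V → V → Prop, IsIntervalOrder G P' →
      (∃ P, IsIntervalOrder G P ∧ ∀ y, ¬ P y z) ∨ ∃ x, P' x z ∧ ∀ w, s 1 x ≤ s 1 w := by
    intro P' hP'
    by_cases hmin : ∀ y, ¬ P' y z
    · exact .inl ⟨P', hP', hmin⟩
    push Not at hmin
    obtain ⟨y, hy⟩ := hmin
    rcases hP'.below_or_module hconn (hs 0) (hs 1) hz hy with h | ⟨M, hM, hMu, hMh, hzM, hyM, -⟩
    · exact .inr h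
    · obtain ⟨Q, hQ⟩ := ih M hM hMu
      refine .inl ⟨substitute P' M Q, hP'.substitute hMh hQ.order, fun y hy => ?_⟩
      by_cases hyM' : y ∈ M
      · refine hQ.first 2 le_rfl ⟨z, hzM⟩ (fun w => hz w) ⟨y, hyM'⟩ ?_
        rw [alternate_even even_two]
        exact (substitute_mem hyM' hzM).mp hy
      · exact hyM' (hyM y ((substitute_left hyM').mp hy))
  rcases key P hP with h | ⟨x, hxz, hx⟩
  · exact h
  rcases key _ hP.swap with h | ⟨x', hxz', hx'⟩
  · exact h
  obtain rfl : x = x' := (hs 0).inj (le_antisymm (hx x') (hx' x))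
  exact absurd hxz (hP.asymm hxz')

/-- The pair `a, b` is eventually ordered `a, b` in the even and `b, a` in the odd sweeps. -/
def Settled (s : ℕ → V → ℕ) (a b : V) : Prop :=
  ∃ N, ∀ i, N ≤ i → if Even i then s i a < s i b else s i b < s i a

theorem Settled.asymm {a b : V} (h : Settled s a b) : ¬ Settled s b a := by
  rintro ⟨N, hN⟩
  obtain ⟨K, hK⟩ := h
  have h1 := hK (K + N) (by omega)
  have h2 := hN (K + N) (by omega)
  split_ifs at h1 h2
  · exact lt_asymm h1 h2
  · exact lt_asymm h1 h2

theorem IsLimit.settled [Finite V] (h : IsLimit G s P)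
    (hs : ∀ i, IsSweep G (s i) (s (i + 1))) {a b : V} (hab : P a b) : Settled s a b := by
  refine ⟨Nat.card V + 1, fun i hi => ?_⟩
  have hinj : Function.Injective (s i) := by
    obtain ⟨j, rfl⟩ : ∃ j, i = j + 1 := ⟨i - 1, by omega⟩
    exact (hs j).inj
  have hne : s i a ≠ s i b := fun h' => h.order.ne hab (hinj h')
  split_ifs with hev
  · by_contra hlt
    refine h.agrees i (by omega) b a (lt_of_le_of_ne (not_lt.mp hlt) hne.symm) ?_
    rwa [alternate_even hev]
  · by_contra hlt
    refine h.agrees i (by omega) a b (lt_of_le_of_ne (not_lt.mp hlt) hne) ?_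
    rwa [alternate_odd hev]

/-- Among the interval orders in which `z`, the first vertex of the second sweep, is minimal, choose
one with the fewest pairs that do not settle. Its restriction to a proper homogeneous module is the
limit order of that module, as otherwise substituting the latter would save a pair. -/
theorem exists_startsRight [Finite V] (hs : ∀ i, IsSweep G (s i) (s (i + 1)))
    (ih : ∀ M : Set V, IsModule G M → M ≠ Set.univ →
      ∃ Q, IsLimit (G.comap (Subtype.val : M → V)) (fun i v => s i v) Q)
    {z : V} (hz : ∀ w, s 2 z ≤ s 2 w) (h : ∃ P, IsIntervalOrder G P ∧ ∀ y, ¬ P y z) :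
    ∃ P, IsIntervalOrder G P ∧ (∀ y, ¬ P y z) ∧
      ∀ i, 2 ≤ i → StartsRight G (alternate P i) (s i) := by
  let bad : (V → V → Prop) → Set (V × V) := fun P => {p | P p.1 p.2 ∧ ¬ Settled s p.1 p.2}
  obtain ⟨P, ⟨hP, hPz⟩, hmin⟩ : ∃ P, (IsIntervalOrder G P ∧ ∀ y, ¬ P y z) ∧
      ∀ P', (IsIntervalOrder G P' ∧ ∀ y, ¬ P' y z) → (bad P).ncard ≤ (bad P').ncard := by
    classical
    have h' : ∃ n, ∃ P, (IsIntervalOrder G P ∧ ∀ y, ¬ P y z) ∧ (bad P).ncard = n := by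
      obtain ⟨P, hP⟩ := h
      exact ⟨_, P, hP, rfl⟩
    obtain ⟨P, hP, hn⟩ := Nat.find_spec h'
    exact ⟨P, hP, fun P' hP' => hn ▸ Nat.find_min' h' ⟨P', hP', rfl⟩⟩
  refine ⟨P, hP, hPz, fun i hi M hM hMu hMh v hv hvmin y hy hyv => ?_⟩
  replace hMh := hMh.of_alternate
  obtain ⟨Q, hQ⟩ := ih M hM hMu
  have hsM : ∀ i, IsSweep (G.comap (Subtype.val : M → V)) (fun v => s i v)
      (fun v => s (i + 1) v) := fun i => (hs i).restrict hM
  have hsettled : ∀ {a b} (ha : a ∈ M) (hb : b ∈ M), Q ⟨a, ha⟩ ⟨b, hb⟩ → Settled s a b :=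
    fun ha hb hab => hQ.settled (s := fun i (v : M) => s i v) hsM hab
  have hsub : bad (substitute P M Q) ⊆ bad P := by
    rintro ⟨a, b⟩ ⟨h1, h2⟩
    refine ⟨?_, h2⟩
    by_cases ha : a ∈ M
    · by_cases hb : b ∈ M
      · exact absurd (hsettled ha hb ((substitute_mem ha hb).mp h1)) h2
      · exact (substitute_right hb).mp h1
    · exact (substitute_left ha).mp h1
  have hle : (bad P).ncard ≤ (bad (substitute P M Q)).ncard := by
    refine hmin _ ⟨hP.substitute hMh hQ.order, fun w hw => ?_⟩
    by_cases hwM : w ∈ M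
    · by_cases hzM : z ∈ M
      · refine hQ.first 2 le_rfl ⟨z, hzM⟩ (fun w => hz w) ⟨w, hwM⟩ ?_
        rw [alternate_even even_two]
        exact (substitute_mem hwM hzM).mp hw
      · exact hPz w ((substitute_right hzM).mp hw)
    · exact hPz w ((substitute_left hwM).mp hw)
  have heq : bad (substitute P M Q) = bad P := Set.eq_of_subset_of_ncard_le hsub hle
  -- hence `P` and `Q` coincide on `M`
  have hPQ : ∀ {a b} (ha : a ∈ M) (hb : b ∈ M), P a b → Q ⟨a, ha⟩ ⟨b, hb⟩ := by
    intro a b ha hb hab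
    by_contra hn
    have hba : Q ⟨b, hb⟩ ⟨a, ha⟩ :=
      (hQ.order.total (fun h => hP.ne hab (congrArg Subtype.val h))
        (hP.not_adj hab)).resolve_left hn
    have hmem : (a, b) ∈ bad P := ⟨hab, (hsettled hb ha hba).asymm⟩
    rw [← heq] at hmem
    exact hn ((substitute_mem ha hb).mp hmem.1)
  refine hQ.first i hi ⟨v, hv⟩ (fun w => hvmin w w.2) ⟨y, hy⟩ ?_
  unfold alternate at hyv ⊢
  split_ifs at hyv ⊢
  · exact hPQ hy hv hyv
  · exact hPQ hv hy hyv

/-- On a connected graph the order `P` of `exists_startsRight` is a limit order: the good parts of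
the second and the third sweep contain at least two vertices, and they grow by two vertices in every
two sweeps. -/
theorem exists_isLimit_of_connected [Finite V] [Nontrivial V] {P₀ : V → V → Prop}
    (hP₀ : IsIntervalOrder G P₀)
    (hconn : ∀ A : Set V, A.Nonempty → A ≠ Set.univ → ∃ a ∈ A, ∃ b ∉ A, G.Adj a b)
    (hs : ∀ i, IsSweep G (s i) (s (i + 1)))
    (ih : ∀ M : Set V, IsModule G M → M ≠ Set.univ →
      ∃ Q, IsLimit (G.comap (Subtype.val : M → V)) (fun i v => s i v) Q) :
    ∃ P, IsLimit G s P := by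
  have hfirst : ∀ i, ∃ z, ∀ w, s i z ≤ s i w := fun i => by
    obtain ⟨z, -, hz⟩ := exists_first (s i) (fun _ => True) ⟨Classical.arbitrary V, trivial⟩
    exact ⟨z, fun w => hz w trivial⟩
  obtain ⟨z₂, hz₂⟩ := hfirst 2
  obtain ⟨P, hP, hPz, hmod⟩ :=
    exists_startsRight hs ih hz₂ (exists_minimal_first hP₀ hconn hs ih hz₂)
  have hmin : ∀ i, 2 ≤ i → ∀ z, (∀ w, s i z ≤ s i w) → ∀ y, ¬ alternate P i y z := by
    intro i hi
    induction i, hi using Nat.le_induction with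
    | base =>
      intro z hz y hyz
      obtain rfl : z = z₂ := (hs 1).inj (le_antisymm (hz z₂) (hz₂ z))
      rw [alternate_even even_two] at hyz
      exact hPz y hyz
    | succ i hi ih' =>
      intro z hz y hyz
      obtain ⟨j, rfl⟩ : ∃ j, i = j + 1 := ⟨i - 1, by omega⟩
      rcases (hP.alternate (j + 1 + 1)).below_or_module hconn (hs j) (hs (j + 1)) hz hyz with
        ⟨x, hxz, hx⟩ | ⟨M, hM, hMu, hMh, hzM, -, x, hxM, hxz⟩
      · exact ih' x hx z (alternate_succ.mp hxz)
      · exact hmod _ (by omega) M hM hMu hMh z hzM (fun w _ => hz w) x hxM hxz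
  have hfirst_mem : ∀ i, 2 ≤ i → ∀ z, (∀ w, s i z ≤ s i w) →
      z ∈ goodPart (alternate P i) (s i) := by
    intro i hi z hz w hwz y _
    obtain ⟨j, rfl⟩ : ∃ j, i = j + 1 := ⟨i - 1, by omega⟩
    obtain rfl : w = z := (hs j).inj (le_antisymm hwz (hz w))
    exact hmin _ hi w hz y
  -- the second vertex is good as well, since the first one is simplicial
  have htwo : ∀ i, 2 ≤ i → 2 ≤ (goodPart (alternate P i) (s i)).ncard := by
    intro i hi
    obtain ⟨j, rfl⟩ : ∃ j, i = j + 2 := ⟨i - 2, by omega⟩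
    have hsw := hs (j + 1)
    have hPi := hP.alternate (j + 2)
    obtain ⟨z, hz⟩ := hfirst (j + 2)
    have hlt : ∀ w, w ≠ z → s (j + 2) z < s (j + 2) w := fun w hw =>
      lt_of_le_of_ne (hz w) fun h => hw (hsw.inj h).symm
    obtain ⟨v, hvz, hv⟩ := exists_first (s (j + 2)) (fun v => v ≠ z) (exists_ne z)
    have hbefore : ∀ c, s (j + 2) c < s (j + 2) v → c = z := fun c hc => by
      by_contra h
      exact absurd (hv c h) (not_le.mpr hc)
    have hzv : G.Adj z v := by
      by_contra hzv
      obtain ⟨a, rfl, b, hb, hab⟩ := hconn {z} (Set.singleton_nonempty z) fun h =>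
        hvz (h ▸ Set.mem_univ v : v ∈ ({z} : Set V))
      have hvb : s (j + 2) v < s (j + 2) b := lt_of_le_of_ne (hv b hb) fun h =>
        hzv (hsw.inj h ▸ hab)
      obtain ⟨d, hd, -⟩ := hsw.exists_private hvb (hlt v hvz) hab hzv
      exact absurd (hz d) (not_le.mpr hd)
    have hlast : ∀ w, w ≠ z → s (j + 1) w < s (j + 1) z := fun w hw =>
      (hsw.tie (hlt w hw) fun c hc _ => absurd (hz c) (not_le.mpr hc)).2
    have hvgood : v ∈ goodPart (alternate P (j + 2)) (s (j + 2)) := by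
      intro w hw y hwy hyw
      rcases hw.eq_or_lt with h | h
      · obtain rfl : w = v := hsw.inj h
        have hyz : y ≠ z := by
          rintro rfl
          exact absurd (hz w) (not_le.mpr hwy)
        by_cases hzy : G.Adj z y
        · exact hPi.not_adj hyw ((hs j).adj_of_earlier hP (hlast y hyz) (hlast w hvz)
            hzy.symm hzv.symm (hPi.ne hyw))
        · exact hPi.not_adj (hPi.trans (hPi.left hzy hyz.symm (hmin _ hi z hz y)) hyw) hzv
      · obtain rfl := hbefore w h
        exact hmin _ hi w hz y hyw
    have hsub : ({z, v} : Set V) ⊆ goodPart (alternate P (j + 2)) (s (j + 2)) := by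
      rintro w (rfl | rfl)
      · exact hfirst_mem _ hi _ hz
      · exact hvgood
    exact (Set.ncard_pair hvz.symm).symm.le.trans (Set.ncard_le_ncard hsub)
  have hgrow : ∀ k i, i < 2 →
      goodPart (alternate P (2 * k + 2 + i)) (s (2 * k + 2 + i)) = Set.univ ∨
      2 * k + 2 ≤ (goodPart (alternate P (2 * k + 2 + i)) (s (2 * k + 2 + i))).ncard := by
    intro k i hi
    induction k with
    | zero => exact .inr (htwo _ (by omega))
    | succ k ihk =>
      by_contra! h
      obtain ⟨hu, hlt⟩ := h
      obtain ⟨j, hj⟩ : ∃ j, 2 * k + 2 + i = j + 2 := ⟨2 * k + i, by omega⟩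
      have hj' : 2 * (k + 1) + 2 + i = j + 4 := by omega
      rw [hj'] at hu hlt
      rw [hj] at ihk
      have hne : (goodPart (alternate P (j + 4)) (s (j + 4))).Nonempty := by
        obtain ⟨z, hz⟩ := hfirst (j + 4)
        exact ⟨z, hfirst_mem _ (by omega) z hz⟩
      have hm := hmod (j + 4) (by omega)
      have hgr : (goodPart (alternate P (j + 4)) (s (j + 2))).ncard + 2 ≤
          (goodPart (alternate P (j + 4)) (s (j + 4))).ncard :=
        hm.ncard_goodPart (hP.alternate _) (hs j) (hs (j + 1)) (hs (j + 2)) (hs (j + 3)) hne hu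
      have halt : alternate P (j + 4) = alternate P (j + 2) := alternate_add_two
      rw [halt] at hgr hlt
      rcases ihk with h | h
      · rw [h] at hgr
        have h1 := Set.ncard_le_card (goodPart (alternate P (j + 2)) (s (j + 4)))
        rw [Set.ncard_univ] at hgr
        omega
      · omega
  refine ⟨P, hP, hmin, fun i hi a b hab hba => ?_⟩
  have hcard : 2 ≤ Nat.card V := Finite.one_lt_card
  have hi2 : 2 ≤ i := hcard.trans hi
  obtain ⟨k, r, hr, rfl⟩ : ∃ k r, r < 2 ∧ i = 2 * k + 2 + r :=
    ⟨(i - 2) / 2, (i - 2) % 2, Nat.mod_lt _ two_pos, by omega⟩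
  have hinj : Function.Injective (s (2 * k + 2 + r)) := (hs (2 * k + 1 + r)).inj |> fun h => by
    rwa [show 2 * k + 1 + r + 1 = 2 * k + 2 + r by omega] at h
  have hD := isGoodPrefix_goodPart (P := alternate P (2 * k + 2 + r)) (σ := s (2 * k + 2 + r))
  have ha : a ∉ goodPart (alternate P (2 * k + 2 + r)) (s (2 * k + 2 + r)) := fun h =>
    hD.good h hab hba
  have hb : b ∉ goodPart (alternate P (2 * k + 2 + r)) (s (2 * k + 2 + r)) := fun h =>
    ha (hD.lower h hab)
  rcases hgrow k r hr with h | h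
  · exact ha (h ▸ Set.mem_univ a)
  · -- two vertices are missing from the good part, which has at least `|V| - 1` elements
    have h1 : ({a, b} : Set V) ⊆ (goodPart (alternate P (2 * k + 2 + r)) (s (2 * k + 2 + r)))ᶜ := by
      rintro w (rfl | rfl)
      · exact ha
      · exact hb
    have h2 := Set.ncard_le_ncard h1
    rw [Set.ncard_pair (fun h => by rw [h] at hab; exact lt_irrefl _ hab)] at h2
    have h3 := Set.ncard_add_ncard_compl
      (goodPart (alternate P (2 * k + 2 + r)) (s (2 * k + 2 + r)))
    omega

end

universe u

/-- Every sequence of `LexBFS⁺` sweeps of an interval graph has a limit order. The induction passes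
to proper modules, and for a disconnected graph to a component and its complement. -/
theorem exists_isLimit : ∀ n : ℕ, ∀ {V : Type u} [Finite V], Nat.card V = n →
    ∀ {G : SimpleGraph V} {P₀ : V → V → Prop} {s : ℕ → V → ℕ}, IsIntervalOrder G P₀ →
    (∀ i, IsSweep G (s i) (s (i + 1))) → ∃ P, IsLimit G s P := by
  intro n
  induction n using Nat.strong_induction_on with
  | _ n ih =>
    intro V _ hn G P₀ s hP₀ hs
    rcases subsingleton_or_nontrivial V with hV | hV
    · have hno : ∀ i a b, ¬ alternate P₀ i a b := fun i a b h =>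
        (hP₀.alternate i).ne h (Subsingleton.elim a b)
      exact ⟨P₀, hP₀, fun i _ z _ y => hno i y z, fun i _ a b _ => hno i b a⟩
    have ih' : ∀ M : Set V, IsModule G M → M ≠ Set.univ →
        ∃ Q, IsLimit (G.comap (Subtype.val : M → V)) (fun i v => s i v) Q := by
      intro M hM hMu
      obtain ⟨c, hc⟩ := (Set.ne_univ_iff_exists_notMem _).mp hMu
      exact ih (Nat.card M) (hn ▸ Finite.card_subtype_lt hc) rfl (hP₀.restrict M)
        fun i => (hs i).restrict hM
    obtain ⟨e, -, he⟩ := exists_first (s 2) (fun _ => True) ⟨Classical.arbitrary V, trivial⟩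
    by_cases hC : {v | G.Reachable e v} = Set.univ
    · refine exists_isLimit_of_connected hP₀ (fun A hA hAu => ?_) hs ih'
      obtain ⟨a, ha⟩ := hA
      obtain ⟨b, hb⟩ := (Set.ne_univ_iff_exists_notMem _).mp hAu
      have hea : G.Reachable e a := Set.eq_univ_iff_forall.mp hC a
      have heb : G.Reachable e b := Set.eq_univ_iff_forall.mp hC b
      obtain ⟨p⟩ := hea.symm.trans heb
      obtain ⟨d, -, hd1, hd2⟩ := p.exists_boundary_dart A ha hb
      exact ⟨_, hd1, _, hd2, d.adj⟩
    · have hnadj : ∀ a, G.Reachable e a → ∀ b, ¬ G.Reachable e b → ¬ G.Adj a b :=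
        fun a ha b hb h => hb (ha.trans h.reachable)
      obtain ⟨P₁, h₁⟩ := ih' {v | G.Reachable e v} (fun c hc a ha b hb =>
        iff_of_false (fun h => hnadj a ha c hc h.symm) (fun h => hnadj b hb c hc h.symm)) hC
      obtain ⟨P₂, h₂⟩ := ih' {v | G.Reachable e v}ᶜ (fun c hc a ha b hb =>
        iff_of_false (hnadj c (not_not.mp hc) a ha) (hnadj c (not_not.mp hc) b hb))
        (Set.compl_ne_univ.mpr ⟨e, SimpleGraph.Reachable.refl e⟩)
      exact exists_isLimit_of_disconnected hP₀ hs (fun w => he w trivial) (fun _ => Iff.rfl)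
        hC h₁ h₂

/-! ### The search produces sweeps -/

/-- Two words obtained from subsets of a list of indices by a strictly decreasing coding of the
indices are compared lexicographically by the first index on which the subsets differ. -/
theorem first_difference {g : ℕ → ℕ} (p q : ℕ → Bool) : ∀ l : List ℕ, l.Pairwise (· < ·) →
    l.Pairwise (fun i j => g j < g i) → (l.filter q).map g ≤ (l.filter p).map g →
    (∀ i ∈ l, p i = q i) ∨
      ∃ i ∈ l, p i = true ∧ q i = false ∧ ∀ j ∈ l, j < i → p j = q j
  | [], _, _, _ => .inl (by simp)
  | h :: t, hl, hg, hle => by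
    rw [List.pairwise_cons] at hl hg
    have hrec : p h = q h → (t.filter q).map g ≤ (t.filter p).map g →
        (∀ i ∈ h :: t, p i = q i) ∨
          ∃ i ∈ h :: t, p i = true ∧ q i = false ∧ ∀ j ∈ h :: t, j < i → p j = q j := by
      intro heq hle'
      rcases first_difference p q t hl.2 hg.2 hle' with h' | ⟨i, hi, h1, h2, h3⟩
      · exact .inl (by simpa [heq] using h')
      · refine .inr ⟨i, List.mem_cons_of_mem _ hi, h1, h2, fun j hj hji => ?_⟩
        rcases List.mem_cons.mp hj with rfl | hj
        · exact heq
        · exact h3 j hj hji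
    cases hp : p h <;> cases hq : q h
    · simp only [List.filter_cons, hp, hq] at hle
      exact hrec (hp.trans hq.symm) (by simpa using hle)
    · -- the larger word would begin with the letter of `h`
      exfalso
      simp only [List.filter_cons, hp, hq, Bool.false_eq_true, if_false, if_true,
        List.map_cons] at hle
      cases hw : (t.filter p).map g with
      | nil =>
        rw [hw] at hle
        exact not_lt.mpr hle List.Lex.nil
      | cons x w =>
        have hx : x ∈ (t.filter p).map g := by simp [hw]
        obtain ⟨i, hi, rfl⟩ := List.mem_map.mp hx
        have hlt := hg.1 i (List.mem_filter.mp hi).1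
        rw [hw] at hle
        exact not_lt.mpr hle (List.Lex.rel hlt)
    · refine .inr ⟨h, List.mem_cons_self, hp, hq, fun j hj hjh => ?_⟩
      rcases List.mem_cons.mp hj with rfl | hj
      · exact absurd hjh (lt_irrefl _)
      · exact absurd hjh (not_lt.mpr (hl.1 j hj).le)
    · simp only [List.filter_cons, hp, hq, if_true, List.map_cons] at hle
      exact hrec (hp.trans hq.symm) (not_lt.mp fun h' => not_lt.mpr hle (List.Lex.cons h'))

theorem le_rightmost {V : Type*} [Fintype V] {σ : Ordering V} {T : Finset V} (hT : T.Nonempty)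
    {v : V} (hv : v ∈ T) :
    σ v ≤ σ (rightmost σ T hT) := by
  rw [rightmost, Equiv.apply_symm_apply]
  exact Finset.le_max' _ _ (Finset.mem_image_of_mem σ hv)

section

variable {V : Type*} [Fintype V] [DecidableEq V] (G : SimpleGraph V) [DecidableRel G.Adj]

theorem run_succ (σ : Ordering V) {k : ℕ} (hk : k < Fintype.card V) :
    ∃ h, run G σ (k + 1) = (run G σ k).number G (rightmost σ (run G σ k).tied h) := by
  obtain ⟨hnd, hlen⟩ := run_visited G σ k hk.le
  have hun : (run G σ k).unnumbered.Nonempty := by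
    by_contra hne
    have hall : ∀ v, v ∈ (run G σ k).visited := fun v => by
      by_contra hv
      exact hne ⟨v, by simpa [State.unnumbered] using hv⟩
    have h1 : (run G σ k).visited.toFinset = Finset.univ := by
      ext v
      simp [hall v]
    have h2 := List.toFinset_card_of_nodup hnd
    rw [h1, Finset.card_univ] at h2
    omega
  have ht := (run G σ k).tied_nonempty hun
  refine ⟨ht, ?_⟩
  exact (Function.iterate_succ_apply' _ _ _).trans (dif_pos ht)

theorem run_visited_eq_take (σ : Ordering V) {k : ℕ} (hk : k ≤ Fintype.card V) :
    (run G σ k).visited = (run G σ (Fintype.card V)).visited.take k := by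
  have key : ∀ m, k + m ≤ Fintype.card V →
      (run G σ k).visited <+: (run G σ (k + m)).visited := by
    intro m
    induction m with
    | zero => exact fun _ => List.prefix_rfl
    | succ m ih =>
      intro hm
      obtain ⟨h, hr⟩ := run_succ G σ (k := k + m) (by omega)
      rw [← add_assoc, hr]
      exact (ih (by omega)).trans (List.prefix_append _ _)
  have h := key (Fintype.card V - k) (by omega)
  rw [show k + (Fintype.card V - k) = Fintype.card V by omega, List.prefix_iff_eq_take] at h
  rwa [(run_visited G σ k hk).2] at h

theorem getElem_lexBFSPlus (σ : Ordering V) (v : V)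
    (h : (lexBFSPlus G σ v : ℕ) < (run G σ (Fintype.card V)).visited.length) :
    (run G σ (Fintype.card V)).visited[(lexBFSPlus G σ v : ℕ)] = v := by
  exact ((run_visited G σ (Fintype.card V) le_rfl).1.getEquivOfForallMemList _
    (run_complete G σ)).apply_symm_apply v

theorem mem_run_visited (σ : Ordering V) {k : ℕ} (hk : k ≤ Fintype.card V) (v : V) :
    v ∈ (run G σ k).visited ↔ (lexBFSPlus G σ v : ℕ) < k := by
  obtain ⟨hnd, hlen⟩ := run_visited G σ (Fintype.card V) le_rfl
  have hv : (lexBFSPlus G σ v : ℕ) < (run G σ (Fintype.card V)).visited.length :=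
    hlen.symm ▸ (lexBFSPlus G σ v).2
  rw [run_visited_eq_take G σ hk, List.mem_take_iff_getElem]
  constructor
  · rintro ⟨i, hi, h⟩
    have h1 := (hnd.getElem_inj_iff).mp (h.trans (getElem_lexBFSPlus G σ v hv).symm)
    omega
  · exact fun h => ⟨_, by omega, getElem_lexBFSPlus G σ v hv⟩

/-- The vertex in position `k` of the sweep, counting from `0`, is the one numbered by the step that
leads from state `k` to state `k + 1`. -/
theorem run_succ_eq_number (σ : Ordering V) (v : V) : ∃ h,
    v = rightmost σ (run G σ (lexBFSPlus G σ v)).tied h ∧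
      run G σ (lexBFSPlus G σ v + 1) = (run G σ (lexBFSPlus G σ v)).number G v := by
  obtain ⟨h, hr⟩ := run_succ G σ (lexBFSPlus G σ v).2
  have h1 : v ∈ (run G σ (lexBFSPlus G σ v + 1)).visited :=
    (mem_run_visited G σ (lexBFSPlus G σ v).2 v).mpr (Nat.lt_succ_self _)
  have h2 : v ∉ (run G σ (lexBFSPlus G σ v)).visited := fun h' =>
    lt_irrefl _ ((mem_run_visited G σ (lexBFSPlus G σ v).2.le v).mp h')
  rw [hr] at h1
  have h3 : v = rightmost σ (run G σ (lexBFSPlus G σ v)).tied h := by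
    rcases List.mem_append.mp h1 with h' | h'
    · exact absurd h' h2
    · exact List.mem_singleton.mp h'
  exact ⟨h, h3, hr.trans (by rw [← h3])⟩

open Classical in
/-- The label of an unnumbered vertex lists its numbered neighbours, after the letter that marks the
start vertex. -/
theorem run_label (σ : Ordering V) : ∀ k ≤ Fintype.card V, ∀ w ∉ (run G σ k).visited,
    (run G σ k).label w = (initialState σ).label w ++
      ((List.range k).filter fun i => ∃ c, (lexBFSPlus G σ c : ℕ) = i ∧ G.Adj c w).map
        fun i => Fintype.card V - (i + 1) := by
  intro k
  induction k with
  | zero => simp [run]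
  | succ k ih =>
    intro hk w hw
    have hv : ∃ v, (lexBFSPlus G σ v : ℕ) = k :=
      ⟨(lexBFSPlus G σ).symm ⟨k, hk⟩, by simp⟩
    obtain ⟨v, rfl⟩ := hv
    obtain ⟨-, -, hr⟩ := run_succ_eq_number G σ v
    have hlen := (run_visited G σ (lexBFSPlus G σ v) (by omega)).2
    rw [hr] at hw ⊢
    have hw' : w ∉ (run G σ (lexBFSPlus G σ v)).visited := fun h => hw (List.mem_append_left _ h)
    have hex : (∃ c, (lexBFSPlus G σ c : ℕ) = lexBFSPlus G σ v ∧ G.Adj c w) ↔ G.Adj v w := by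
      constructor
      · rintro ⟨c, hc, hcw⟩
        rwa [← (lexBFSPlus G σ).injective (Fin.ext hc)]
      · exact fun h => ⟨v, rfl, h⟩
    have hw2 : w ∉ (run G σ (lexBFSPlus G σ v)).visited ++ [v] := hw
    rw [List.range_succ, List.filter_append, List.map_append, ← List.append_assoc,
      ← ih (by omega) w hw']
    by_cases hvw : G.Adj v w
    · simp [State.number, hvw, hlen, hex]
      simpa using hw2
    · simp [State.number, hvw, hex]

theorem isSweep_lexBFSPlus (σ : Ordering V) :
    IsSweep G (fun v => σ v) (fun v => lexBFSPlus G σ v) where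
  inj a b h := (lexBFSPlus G σ).injective (Fin.ext h)
  lex {a b} hab := by
    classical
    have hab' : (lexBFSPlus G σ a : ℕ) < lexBFSPlus G σ b := hab
    have hne : b ≠ a := by rintro rfl; exact lt_irrefl _ hab'
    have hchosen : ∀ v, (∀ u ∈ (run G σ (lexBFSPlus G σ v)).unnumbered,
          (run G σ (lexBFSPlus G σ v)).label u ≤ (run G σ (lexBFSPlus G σ v)).label v) ∧
        ∀ u ∈ (run G σ (lexBFSPlus G σ v)).unnumbered, (run G σ (lexBFSPlus G σ v)).label u =
          (run G σ (lexBFSPlus G σ v)).label v → σ u ≤ σ v := by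
      intro v
      obtain ⟨h, hv, -⟩ := run_succ_eq_number G σ v
      have hmem := rightmost_mem σ _ h
      rw [← hv] at hmem
      have hmax := (Finset.mem_filter.mp hmem).2
      refine ⟨hmax, fun u hu hl => ?_⟩
      have hut : u ∈ (run G σ (lexBFSPlus G σ v)).tied :=
        Finset.mem_filter.mpr ⟨hu, fun w hw => hl ▸ hmax w hw⟩
      have := le_rightmost (σ := σ) h hut
      rwa [← hv] at this
    have hun : ∀ v u, (lexBFSPlus G σ v : ℕ) ≤ lexBFSPlus G σ u →
        u ∈ (run G σ (lexBFSPlus G σ v)).unnumbered := by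
      intro v u h
      simp only [State.unnumbered, Finset.mem_filter, Finset.mem_univ, true_and,
        mem_run_visited G σ (lexBFSPlus G σ v).2.le]
      omega
    -- the first vertex numbered is the last vertex of `σ`
    have hstart : ∀ v, (lexBFSPlus G σ v : ℕ) = 0 → (σ v : ℕ) + 1 = Fintype.card V := by
      intro v hv
      have hpos : 0 < Fintype.card V := Fintype.card_pos_iff.mpr ⟨v⟩
      have h := (hchosen v).1 (σ.symm ⟨Fintype.card V - 1, by omega⟩) (hun v _ (by omega))
      rw [hv] at h
      by_contra hne'
      have h1 : Fintype.card V - 1 + 1 = Fintype.card V := by omega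
      simp only [run, initialState, Function.iterate_zero, id_eq, Equiv.apply_symm_apply, h1,
        if_true, hne', if_false] at h
      exact not_lt.mpr h List.Lex.nil
    rcases Nat.eq_zero_or_pos (lexBFSPlus G σ a : ℕ) with h0 | hpos
    · refine .inr ⟨fun c hc => absurd hc (by omega), ?_⟩
      have h1 := hstart a h0
      have h2 : (σ b : ℕ) ≠ σ a := fun h => hne (σ.injective (Fin.ext h))
      have h3 := (σ b).2
      omega
    · have hinit : ∀ v, 0 < (lexBFSPlus G σ v : ℕ) → (initialState σ).label v = [] := by
        intro v hv
        have hn : 0 < Fintype.card V := by omega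
        have h1 := hstart ((lexBFSPlus G σ).symm ⟨0, hn⟩) (by simp)
        have h2 : ¬ (σ v : ℕ) + 1 = Fintype.card V := by
          intro h
          have h3 : v = (lexBFSPlus G σ).symm ⟨0, hn⟩ := σ.injective (Fin.ext (by omega))
          rw [h3] at hv
          simp at hv
        simp [initialState, h2]
      have hka := (lexBFSPlus G σ a).2.le
      have hla := run_label G σ _ hka a fun h => lt_irrefl _ ((mem_run_visited G σ hka a).mp h)
      have hlb := run_label G σ _ hka b fun h =>
        lt_asymm hab' ((mem_run_visited G σ hka b).mp h)
      rw [hinit a hpos, List.nil_append] at hla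
      rw [hinit b (by omega), List.nil_append] at hlb
      have hle := (hchosen a).1 b (hun a b hab'.le)
      rw [hla, hlb] at hle
      rcases first_difference _ _ _ List.pairwise_lt_range
        (List.pairwise_lt_range.imp_of_mem fun {i j} hi hj hij => by
          have := List.mem_range.mp hj
          omega) hle with h | ⟨i, hi, h1, h2, h3⟩
      · refine .inr ⟨fun c hc => ?_, ?_⟩
        · have h' := h (lexBFSPlus G σ c) (List.mem_range.mpr hc)
          rw [decide_eq_decide] at h'
          constructor
          · intro hca
            obtain ⟨d, hd, hdb⟩ := h'.mp ⟨c, rfl, hca⟩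
            rwa [← (lexBFSPlus G σ).injective (Fin.ext hd)]
          · intro hcb
            obtain ⟨d, hd, hda⟩ := h'.mpr ⟨c, rfl, hcb⟩
            rwa [← (lexBFSPlus G σ).injective (Fin.ext hd)]
        · refine lt_of_le_of_ne ((hchosen a).2 b (hun a b hab'.le) ?_) fun h' =>
            hne (σ.injective (Fin.ext h'))
          rw [hla, hlb, List.filter_congr fun i hi => (h i hi).symm]
      · rw [decide_eq_true_eq] at h1
        rw [decide_eq_false_iff_not] at h2
        obtain ⟨c, rfl, hca⟩ := h1
        refine .inl ⟨c, List.mem_range.mp hi, hca, fun h => h2 ⟨c, rfl, h⟩, fun d hd => ?_⟩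
        have h' := h3 (lexBFSPlus G σ d) (List.mem_range.mpr
          (lt_trans hd (List.mem_range.mp hi))) hd
        rw [decide_eq_decide] at h'
        constructor
        · intro hda
          obtain ⟨e, he, heb⟩ := h'.mp ⟨d, rfl, hda⟩
          rwa [← (lexBFSPlus G σ).injective (Fin.ext he)]
        · intro hdb
          obtain ⟨e, he, hea⟩ := h'.mpr ⟨d, rfl, hdb⟩
          rwa [← (lexBFSPlus G σ).injective (Fin.ext he)]

end

/-! ### Sweeps of left endpoint orders -/

section

variable {V : Type*} {G : SimpleGraph V} {P : V → V → Prop} {σ τ π ρ : V → ℕ}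

/-- `σ` orders the vertices as the left endpoints of an interval representation do: every vertex
between `a` and a later neighbour of `a` is adjacent to `a`. -/
def IsLeftOrder (G : SimpleGraph V) (σ : V → ℕ) : Prop :=
  ∀ a b c, σ a < σ b → σ b < σ c → G.Adj a c → G.Adj a b

/-- `LexBFS` orderings that are cocomparability orders are left endpoint orders, since the earlier
neighbours of a vertex form a clique. -/
theorem IsSweep.isLeftOrder (h : IsSweep G σ τ) (hP : IsIntervalOrder G P)
    (hτ : ∀ a b c, τ a < τ b → τ b < τ c → G.Adj a c → G.Adj a b ∨ G.Adj b c) :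
    IsLeftOrder G τ := by
  intro a b c hab hbc hac
  rcases hτ a b c hab hbc hac with h' | h'
  · exact h'
  · exact h.adj_of_earlier hP (hab.trans hbc) hbc hac h' (by rintro rfl; exact lt_irrefl _ hab)

variable [Fintype V]

open Classical in
/-- The last position in `σ` of a vertex of the closed neighbourhood of `a`. -/
noncomputable def reach (G : SimpleGraph V) (σ : V → ℕ) (a : V) : ℕ :=
  (Finset.univ.filter fun b => a = b ∨ G.Adj a b).sup σ

theorem le_reach {a b : V} (h : a = b ∨ G.Adj a b) : σ b ≤ reach G σ a := by
  classical
  exact Finset.le_sup (f := σ) (Finset.mem_filter.mpr ⟨Finset.mem_univ b, h⟩)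

theorem exists_eq_reach (G : SimpleGraph V) (σ : V → ℕ) (a : V) :
    ∃ b, (a = b ∨ G.Adj a b) ∧ σ b = reach G σ a := by
  classical
  obtain ⟨b, hb, h⟩ := Finset.exists_mem_eq_sup (Finset.univ.filter fun b => a = b ∨ G.Adj a b)
    ⟨a, Finset.mem_filter.mpr ⟨Finset.mem_univ a, .inl rfl⟩⟩ σ
  exact ⟨b, (Finset.mem_filter.mp hb).2, h.symm⟩

/-- In a left endpoint order the vertices are represented by the intervals `[σ a, reach a]`. -/
theorem IsLeftOrder.mem_iff (h : IsLeftOrder G σ) (hσ : Function.Injective σ) {a b : V} :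
    (a = b ∨ G.Adj a b) ↔ σ a ≤ reach G σ b ∧ σ b ≤ reach G σ a := by
  refine ⟨fun hab => ⟨le_reach (hab.imp Eq.symm fun h => h.symm), le_reach hab⟩, ?_⟩
  have key : ∀ a b, σ a < σ b → σ b ≤ reach G σ a → G.Adj a b := by
    intro a b hab hb
    obtain ⟨c, hc, hca⟩ := exists_eq_reach G σ a
    rcases hc with rfl | hc
    · omega
    · rcases (hca ▸ hb : σ b ≤ σ c).eq_or_lt with h' | h'
      · rwa [hσ h']
      · exact h a b c hab h' hc
  rintro ⟨h1, h2⟩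
  rcases lt_trichotomy (σ a) (σ b) with h' | h' | h'
  · exact .inr (key a b h' h2)
  · exact .inl (hσ h')
  · exact .inr (key b a h' h1).symm

/-- The pair of the right and the left endpoint of a vertex, compared lexicographically. -/
noncomputable def endpoints (G : SimpleGraph V) (σ : V → ℕ) (a : V) : ℕ ×ₗ ℕ :=
  toLex (reach G σ a, σ a)

theorem endpoints_lt {a b : V} : endpoints G σ a < endpoints G σ b ↔
    reach G σ a < reach G σ b ∨ reach G σ a = reach G σ b ∧ σ a < σ b :=
  Prod.Lex.toLex_lt_toLex

theorem reach_le_of_endpoints_le {a b : V} (h : endpoints G σ a ≤ endpoints G σ b) :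
    reach G σ a ≤ reach G σ b := by
  rcases Prod.Lex.toLex_le_toLex.mp h with h | h
  · exact h.le
  · exact h.1.le

/-- The sweep of a left endpoint order numbers the vertices by decreasing right endpoint, and those
with the same right endpoint by decreasing left endpoint. -/
theorem IsSweep.endpoints_lt (h : IsSweep G σ τ) (hσ : Function.Injective σ)
    (hI : IsLeftOrder G σ) {a b : V} (hab : τ a < τ b) :
    endpoints G σ b < endpoints G σ a := by
  classical
  by_contra hn
  obtain ⟨a, ⟨b, hab, hba⟩, hmin⟩ := exists_first τ
    (fun a => ∃ b, τ a < τ b ∧ endpoints G σ a ≤ endpoints G σ b) ⟨a, b, hab, not_lt.mp hn⟩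
  have hearly : ∀ c, τ c < τ a → ∀ d, τ c < τ d → endpoints G σ d < endpoints G σ c := by
    intro c hc d hd
    by_contra h'
    exact absurd (hmin c ⟨d, hd, not_lt.mp h'⟩) (not_le.mpr hc)
  -- `b` is replaced by the unnumbered vertex with the largest pair of endpoints
  obtain ⟨v, hv, hvmax⟩ := Finset.exists_max_image (Finset.univ.filter fun v => τ a < τ v)
    (endpoints G σ) ⟨b, Finset.mem_filter.mpr ⟨Finset.mem_univ b, hab⟩⟩
  have hav : τ a < τ v := (Finset.mem_filter.mp hv).2
  have hva : endpoints G σ a ≤ endpoints G σ v :=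
    hba.trans (hvmax b (Finset.mem_filter.mpr ⟨Finset.mem_univ b, hab⟩))
  have hreach := reach_le_of_endpoints_le hva
  obtain ⟨hagree, hσva⟩ := h.tie hav fun c hc hca => by
    have h1 := (hI.mem_iff hσ).mp (.inr hca)
    have h2 := reach_le_of_endpoints_le (hearly c hc v (hc.trans hav)).le
    have h3 : σ v ≤ reach G σ v := le_reach (.inl rfl)
    rcases (hI.mem_iff hσ).mpr ⟨h1.1.trans hreach, h3.trans h2⟩ with rfl | h'
    · omega
    · exact h'
  have hlt : reach G σ a < reach G σ v := by
    rcases Prod.Lex.toLex_le_toLex.mp hva with h' | h'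
    · exact h'
    · exact absurd h'.2 (not_le.mpr hσva)
  have ha : σ a ≤ reach G σ a := le_reach (.inl rfl)
  obtain ⟨w, hw, hwv⟩ := exists_eq_reach G σ v
  rcases hw with rfl | hw
  · omega
  have hwa : ¬ G.Adj w a := fun h' => by
    have := le_reach (σ := σ) (.inr h'.symm)
    omega
  have hwane : w ≠ a := by rintro rfl; omega
  have hw' : σ w ≤ reach G σ w := le_reach (.inl rfl)
  have hvle : σ v ≤ reach G σ v := le_reach (.inl rfl)
  have hvw : σ v ≠ σ w := fun h' => G.ne_of_adj hw (hσ h')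
  rcases lt_trichotomy (τ w) (τ a) with h' | h' | h'
  · exact hwa ((hagree w h').mpr hw.symm)
  · exact hwane (h.inj h')
  · refine absurd (hvmax w (Finset.mem_filter.mpr ⟨Finset.mem_univ w, h'⟩)) (not_le.mpr ?_)
    rw [LexBFS.endpoints_lt]
    omega

theorem IsSweep.lt_iff (h : IsSweep G σ τ) (hσ : Function.Injective σ) (hI : IsLeftOrder G σ)
    {a b : V} : τ a < τ b ↔ endpoints G σ b < endpoints G σ a := by
  refine ⟨h.endpoints_lt hσ hI, fun hlt => ?_⟩
  rcases lt_trichotomy (τ a) (τ b) with h' | h' | h'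
  · exact h'
  · exact absurd hlt (h.inj h' ▸ lt_irrefl _)
  · exact absurd hlt (lt_asymm (h.endpoints_lt hσ hI h'))

theorem IsLeftOrder.sweep (hI : IsLeftOrder G σ) (h : IsSweep G σ τ) (hσ : Function.Injective σ) :
    IsLeftOrder G τ := by
  intro a b c hab hbc hac
  have h1 := reach_le_of_endpoints_le (h.endpoints_lt hσ hI hab).le
  have h2 := reach_le_of_endpoints_le (h.endpoints_lt hσ hI hbc).le
  have h3 := (hI.mem_iff hσ).mp (.inr hac)
  have h4 : σ b ≤ reach G σ b := le_reach (.inl rfl)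
  rcases (hI.mem_iff hσ).mpr ⟨h3.1.trans h2, h4.trans h1⟩ with rfl | h'
  · exact absurd hab (lt_irrefl _)
  · exact h'

/-- From the first sweep of a left endpoint order on, the sweeps alternate between two orderings. -/
theorem IsLeftOrder.lt_of_three_sweeps (hI : IsLeftOrder G σ) (hσ : Function.Injective σ)
    (hτ : IsSweep G σ τ) (hπ : IsSweep G τ π) (hρ : IsSweep G π ρ) {a b : V} (hab : τ a < τ b) :
    ρ a < ρ b := by
  have hIτ := hI.sweep hτ hσ
  have hIπ := hIτ.sweep hπ hτ.inj
  have hlt : ∀ {a b}, reach G σ b < reach G σ a → τ a < τ b := fun h =>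
    (hτ.lt_iff hσ hI).mpr (LexBFS.endpoints_lt.mpr (.inl h))
  rw [hρ.lt_iff hπ.inj hIπ, LexBFS.endpoints_lt]
  rcases LexBFS.endpoints_lt.mp (hτ.endpoints_lt hσ hI hab) with h | ⟨h, hσba⟩
  · -- the last neighbour `c` of `a` in `σ` comes after the whole neighbourhood of `b` in `π`
    left
    obtain ⟨c, hac, hc⟩ := exists_eq_reach G σ a
    obtain ⟨x, hbx, hx⟩ := exists_eq_reach G π b
    rw [← hx]
    refine lt_of_lt_of_le ?_ (le_reach hac)
    rw [hπ.lt_iff hτ.inj hIτ, LexBFS.endpoints_lt]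
    left
    obtain ⟨y, hcy, hy⟩ := exists_eq_reach G τ c
    have h1 := ((hI.mem_iff hσ).mp hcy).1
    rw [← hy]
    exact (hlt (by omega)).trans_le (le_reach (hbx.imp Eq.symm fun h => h.symm))
  · -- the neighbourhood of `a` is contained in that of `b`
    have hsub : ∀ y, a = y ∨ G.Adj a y → b = y ∨ G.Adj b y := by
      intro y hy
      have h1 := (hI.mem_iff hσ).mp hy
      exact (hI.mem_iff hσ).mpr ⟨by omega, by omega⟩
    have hba : π b < π a := by
      rw [hπ.lt_iff hτ.inj hIτ, LexBFS.endpoints_lt]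
      obtain ⟨y, hay, hy⟩ := exists_eq_reach G τ a
      have h1 : reach G τ a ≤ reach G τ b := hy ▸ le_reach (hsub y hay)
      omega
    have hle : reach G π b ≤ reach G π a := by
      obtain ⟨c, hbc, hc⟩ := exists_eq_reach G π b
      rw [← hc]
      by_cases hac : a = c ∨ G.Adj a c
      · exact le_reach hac
      · -- a neighbour of `b` only ends, in `σ`, before `a` begins
        have h1 := (hI.mem_iff hσ).mp hbc
        have h2 : reach G σ c < σ a := by
          by_contra h'
          exact hac ((hI.mem_iff hσ).mpr ⟨not_lt.mp h', by omega⟩)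
        have h3 : π c < π a := by
          rw [hπ.lt_iff hτ.inj hIτ, LexBFS.endpoints_lt]
          left
          obtain ⟨y, hay, hy⟩ := exists_eq_reach G τ a
          have h4 := ((hI.mem_iff hσ).mp hay).1
          rw [← hy]
          exact (hlt (by omega)).trans_le (le_reach (.inl rfl))
        exact h3.le.trans (le_reach (.inl rfl))
    omega

end

/-! ### The theorem -/

theorem IsIntervalGraph.exists_isIntervalOrder {V : Type*} {G : SimpleGraph V}
    (hG : IsIntervalGraph G) : ∃ P, IsIntervalOrder G P := by
  obtain ⟨l, r, hlr, hadj⟩ := hG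
  refine ⟨fun a b => r a < l b, ?_, ?_, ?_, ?_, ?_⟩
  · intro a b h h'
    obtain ⟨x, ⟨-, hx⟩, hx', -⟩ := (hadj a b h'.ne).mp h'
    linarith
  · intro a b h h'
    linarith [hlr a, hlr b]
  · intro a b c h h'
    linarith [hlr b]
  · intro a b hne h
    by_contra! h'
    exact h ((hadj a b hne).mpr ⟨max (l a) (l b),
      ⟨le_max_left _ _, max_le (hlr a) h'.1⟩, ⟨le_max_right _ _, max_le h'.2 (hlr b)⟩⟩)
  · intro a b c d h h'
    by_contra! h2
    linarith [h2.1, h2.2]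

theorem Ordering.eq_of_lt {V : Type*} [Fintype V] {σ τ : Ordering V}
    (h : ∀ a b, σ a < σ b → τ a < τ b) : τ = σ := by
  have h1 : StrictMono (σ.symm.trans τ) := fun i j hij => h _ _ (by simpa using hij)
  have h2 : (σ.symm.trans τ : Fin _ → Fin _) = id :=
    (h1.range_inj strictMono_id).mp (by rw [Equiv.range_eq_univ, Set.range_id])
  ext v
  simpa using congrArg Fin.val (congrFun h2 (σ v))

section

variable {V : Type*} [Fintype V] [DecidableEq V] (G : SimpleGraph V) [DecidableRel G.Adj]

theorem sweep_succ (σ : Ordering V) (i : ℕ) : sweep G σ (i + 1) = lexBFSPlus G (sweep G σ i) :=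
  Function.iterate_succ_apply' _ _ _

theorem isSweep_sweep (σ : Ordering V) (i : ℕ) :
    IsSweep G (fun v => sweep G σ i v) (fun v => sweep G σ (i + 1) v) := by
  rw [sweep_succ]
  exact isSweep_lexBFSPlus G _

/-- A sweep differs from the preceding ordering, since it starts with the last vertex of the
latter. -/
theorem lexBFSPlus_ne (hn : 2 ≤ Fintype.card V) (σ : Ordering V) : lexBFSPlus G σ ≠ σ := by
  intro h
  have h1 := isSweep_lexBFSPlus G σ
  rw [h] at h1
  have h2 : ((σ (σ.symm ⟨0, by omega⟩) : Fin _) : ℕ) < σ (σ.symm ⟨1, by omega⟩) := by simp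
  exact lt_asymm h2 (h1.tie h2 fun c hc => absurd hc (by simp)).2

variable {G}

/-- The sweep with number `|V|` is a linear extension of the limit order or of its reverse. -/
theorem exists_cocomp (hG : IsIntervalGraph G) (σ : Ordering V) :
    IsCocompOrder G (sweep G σ (Fintype.card V)) := by
  obtain ⟨P₀, hP₀⟩ := hG.exists_isIntervalOrder
  obtain ⟨P, hP⟩ := exists_isLimit _ rfl hP₀ (isSweep_sweep G σ)
  have hord := hP.order.alternate (Fintype.card V)
  have hlt : ∀ a b, sweep G σ (Fintype.card V) a < sweep G σ (Fintype.card V) b →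
      ¬ G.Adj a b → alternate P (Fintype.card V) a b := fun a b hab hadj =>
    hord.left hadj (by rintro rfl; exact lt_irrefl _ hab)
      (hP.agrees _ Nat.card_eq_fintype_card.le a b hab)
  intro a b c hab hbc hac
  by_contra! h
  exact hord.not_adj (hord.trans (hlt a b hab h.1) (hlt b c hbc h.2)) hac

theorem sweep_add_two (hG : IsIntervalGraph G) (σ : Ordering V) {j : ℕ} (hj : 1 ≤ j)
    (h : IsCocompOrder G (sweep G σ j)) {i : ℕ} (hij : j < i) :
    sweep G σ (i + 2) = sweep G σ i := by
  obtain ⟨P, hP⟩ := hG.exists_isIntervalOrder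
  induction i, hij using Nat.le_induction with
  | base =>
    obtain ⟨k, rfl⟩ : ∃ k, j = k + 1 := ⟨j - 1, by omega⟩
    have hI : IsLeftOrder G (fun v => (sweep G σ (k + 1) v : ℕ)) :=
      (isSweep_sweep G σ k).isLeftOrder hP h
    exact Ordering.eq_of_lt fun a b hab =>
      hI.lt_of_three_sweeps (isSweep_sweep G σ k).inj (isSweep_sweep G σ (k + 1))
        (isSweep_sweep G σ (k + 2)) (isSweep_sweep G σ (k + 3)) hab
  | succ i _ ih => rw [show i + 1 + 2 = i + 2 + 1 from rfl, sweep_succ, ih, sweep_succ]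

/-- An ordering on a cycle returns after two sweeps. -/
theorem minimalPeriod_dvd_two (hn : 2 ≤ Fintype.card V) (hG : IsIntervalGraph G) {σ : Ordering V}
    (hσ : σ ∈ Function.periodicPts (lexBFSPlus G)) :
    Function.minimalPeriod (lexBFSPlus G) σ ∣ 2 := by
  obtain ⟨m, hm, hper⟩ := hσ
  refine Function.IsPeriodicPt.minimalPeriod_dvd ?_
  -- a multiple of the period that exceeds the number of sweeps needed
  have h1 : Fintype.card V < m * (Fintype.card V + 1) := by nlinarith
  have h2 := sweep_add_two hG σ (by omega) (exists_cocomp hG σ) h1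
  have h3 : sweep G σ (m * (Fintype.card V + 1)) = σ := hper.mul_const _
  have h4 : sweep G σ (m * (Fintype.card V + 1) + 2) =
      (lexBFSPlus G)^[2] (sweep G σ (m * (Fintype.card V + 1))) := by
    rw [add_comm]
    exact Function.iterate_add_apply _ _ _ _
  rw [h4, h3] at h2
  exact h2

theorem lexCycle_eq_two (hn : 2 ≤ Fintype.card V) (hG : IsIntervalGraph G) : lexCycle G = 2 := by
  refine le_antisymm (Finset.sup_le fun σ _ => ?_) ?_
  · by_cases hσ : σ ∈ Function.periodicPts (lexBFSPlus G)
    · exact Nat.le_of_dvd two_pos (minimalPeriod_dvd_two hn hG hσ)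
    · rw [Function.minimalPeriod_eq_zero_of_notMem_periodicPts hσ]
      exact Nat.zero_le _
  · let σ : Ordering V := sweep G (Fintype.equivFin V) (Fintype.card V + 1)
    have hper : Function.IsPeriodicPt (lexBFSPlus G) 2 σ := by
      have h := sweep_add_two hG (Fintype.equivFin V) (by omega) (exists_cocomp hG _)
        (Nat.lt_succ_self (Fintype.card V))
      rw [sweep_succ, sweep_succ] at h
      exact h
    have hmin : Function.minimalPeriod (lexBFSPlus G) σ = 2 :=
      Function.minimalPeriod_eq_prime hper (lexBFSPlus_ne G hn σ)
    exact hmin.symm.le.trans (Finset.le_sup (f := fun σ =>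
      Function.minimalPeriod (lexBFSPlus G) σ) (Finset.mem_univ σ))

end

end LexBFS

theorem mainTheorem2 {V : Type*} [Fintype V] [DecidableEq V]
    (G : SimpleGraph V) [DecidableRel G.Adj]
    (hn : 2 ≤ Fintype.card V) (hG : LexBFS.IsIntervalGraph G) :
    LexBFS.lexCycle G = 2 ∧
    ∀ σ : LexBFS.Ordering V,
      (∃ j : ℕ, 1 ≤ j ∧ j ≤ Fintype.card V ∧ LexBFS.IsCocompOrder G (LexBFS.sweep G σ j)) ∧
      ∀ j : ℕ, 1 ≤ j → LexBFS.IsCocompOrder G (LexBFS.sweep G σ j) →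
        ∀ i : ℕ, j < i →
          LexBFS.sweep G σ (i + 2) = LexBFS.sweep G σ i ∧
          LexBFS.sweep G σ (i + 1) ≠ LexBFS.sweep G σ i := by
  refine ⟨LexBFS.lexCycle_eq_two hn hG, fun σ => ⟨⟨Fintype.card V, by omega, le_rfl,
    LexBFS.exists_cocomp hG σ⟩, fun j hj h i hij => ⟨LexBFS.sweep_add_two hG σ hj h hij, ?_⟩⟩⟩
  rw [LexBFS.sweep_succ]
  exact LexBFS.lexBFSPlus_ne G hn _
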